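/- Notation. On $\mathbb R^m$ and $\mathbb R^n$, $|\cdot|$ is the supremum norm, and $|A|_m$ is the $m$-dimensional Lebesgue (outer) measure of $A\subset\mathbb R^m$, $m\ge 1$. For a multiindex $\beta$ put $|\beta|_*=\beta_1+\dots+\beta_m$ and let $\partial_\beta$ be the corresponding partial derivative. For $U\subset\mathbb R^m$ open, $C^{(l)}(U)$ is the space of $l$ times continuously differentiable functions $U\to\mathbb R$ with the topology of uniform convergence of all $\partial_\beta f$, $|\beta|_*\le l$, on compact subsets of $U$. A function $f:V\to\mathbb R$ on an open set $V\subset\mathbb R^m$ is $(C,\alpha)$-good on $V$ (where $C,\alpha>0$) if for every open ball $B\subset V$ and every $\varepsilon>0$ $$\Big|\Big\{x\in B:\ |f(x)|<\varepsilon\,\sup_{y\in B}|f(y)|\Big\}\Big|_m\le C\varepsilon^\alpha|B|_m ;$$ here balls for the supremum norm and Euclidean balls are both admitted. A map $\mathbf f=(f_1,\dots,f_n)$ from an open set $U\subset\mathbb R^m$ to $\mathbb R^n$ is $l$-non-degenerate at $x_0\in U$ if it is $l$ times continuously differentiable on some ball centred at $x_0$ and the vectors $\partial_\beta\mathbf f(x_0)$,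 $0<|\beta|_*\le l$, span $\mathbb R^n$. Let $U\subset\mathbb R^m$ be open, $x_0\in U$ and $l\ge 2$. (1) Let $\mathcal F\subset C^{(l)}(U)$ be compact with $$\inf_{f\in\mathcal F}\ \max_{0<|\beta|_*\le l}|\partial_\beta f(x_0)|>0 .$$ Then there are an open neighbourhood $V\subset U$ of $x_0$ and constants $C,\delta>0$ such that for every $\Theta\in C^{(l)}(U)$ with $\sup_{x\in U}\max_{|\beta|_*\le l}|\partial_\beta\Theta(x)|\le\delta$ and every $f\in\mathcal F$: (a) $f+\Theta$ is $\big(C,\frac1{ml}\big)$-good on $V$; (b) $|\nabla(f+\Theta)|$ is $\big(C,\frac1{m(l-1)}\big)$-good on $V$. (2) Let $\mathbf f:U\to\mathbb R^n$ be $l$-non-degenerate at $x_0$ and let $\theta\in C^{(l)}(U)$. Then there are an open neighbourhood $V\subset U$ of $x_0$ and constants $C,H_0>0$ such that for every $\mathbf a\in\mathbb R^n$ with $|\mathbf a|\ge H_0$: (a) $a_0+\mathbf a\cdot\mathbf f+\theta$ is $\big(C,\frac1{ml}\big)$-good on $V$ for every $a_0\in\mathbb R$; (b) $|\nabla(\mathbf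 a\cdot\mathbf f+\theta)|$ is $\big(C,\frac1{m(l-1)}\big)$-good on $V$. -/

import Mathlib

open Set MeasureTheory
open scoped ENNReal UniformConvergence

noncomputable section

/-- The partial derivative of `f` in the `i`-th coordinate direction. -/
def partialDeriv {m : ℕ} {E : Type*} [NormedAddCommGroup E] [NormedSpace ℝ E]
    (i : Fin m) (f : (Fin m → ℝ) → E) : (Fin m → ℝ) → E :=
  fun x => lineDeriv ℝ f x (Pi.single i 1)

/-- The iterated partial derivative `∂_β f`, where `β` is a multiindex: `β i` derivatives are
taken in the `i`-th coordinate. -/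
def multiDeriv {m : ℕ} {E : Type*} [NormedAddCommGroup E] [NormedSpace ℝ E]
    (β : Fin m → ℕ) (f : (Fin m → ℝ) → E) : (Fin m → ℝ) → E :=
  (List.finRange m).foldr (fun i g => (partialDeriv i)^[β i] g) f

/-- The order `β_1 + ... + β_m` of a multiindex. -/
def multiOrder {m : ℕ} (β : Fin m → ℕ) : ℕ := ∑ i, β i

/-- The gradient. The norm on `Fin m → ℝ` is the supremum norm. -/
def grad {m : ℕ} (f : (Fin m → ℝ) → ℝ) (x : Fin m → ℝ) : Fin m → ℝ :=
  fun i => partialDeriv i f x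

/-- The space `C^(l)(U)` of `l` times continuously differentiable real functions on `U`
(used for open `U`). A function on `U` is represented by its extension by zero. -/
structure CSpace {m : ℕ} (l : ℕ) (U : Set (Fin m → ℝ)) where
  toFun : (Fin m → ℝ) → ℝ
  contDiffOn' : ContDiffOn ℝ l toFun U
  zero_off' : ∀ x, x ∉ U → toFun x = 0

instance CSpace.instCoeFun {m l : ℕ} {U : Set (Fin m → ℝ)} :
    CoeFun (CSpace l U) (fun _ => (Fin m → ℝ) → ℝ) := ⟨CSpace.toFun⟩

/-- All partial derivatives of order at most `l` of an element of `C^(l)(U)`, each regarded as an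
element of the space of functions with the topology of uniform convergence on the compact
subsets of `U`. -/
def CSpace.jet {m l : ℕ} {U : Set (Fin m → ℝ)} (f : CSpace l U) :
    {β : Fin m → ℕ // multiOrder β ≤ l} →
      ((Fin m → ℝ) →ᵤ[{K : Set (Fin m → ℝ) | IsCompact K ∧ K ⊆ U}] ℝ) :=
  fun β => UniformOnFun.ofFun _ (multiDeriv β.1 f)

/-- The usual topology of `C^(l)(U)`: uniform convergence, on each compact subset of `U`, of all
partial derivatives of order at most `l`. -/
instance CSpace.instTopologicalSpace {m l : ℕ} {U : Set (Fin m → ℝ)} :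
    TopologicalSpace (CSpace l U) :=
  TopologicalSpace.induced CSpace.jet inferInstance

/-- `B` is an open ball of `ℝ^m`, for the supremum norm or for the Euclidean norm. -/
def IsOpenBall {m : ℕ} (B : Set (Fin m → ℝ)) : Prop :=
  ∃ (c : Fin m → ℝ) (r : ℝ), 0 < r ∧
    (B = Metric.ball c r ∨ B = {x | ∑ i, (x i - c i) ^ 2 < r ^ 2})

/-- `f` is `(C, α)`-good on `V`. The supremum is taken in `[0, ∞]`. Balls of both usual kinds are
covered, so that the inequality holds for Euclidean balls as well as for supremum norm balls. -/
def IsGoodOn {m : ℕ} (C α : ℝ) (V : Set (Fin m → ℝ)) (f : (Fin m → ℝ) → ℝ) : Prop :=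
  ∀ B : Set (Fin m → ℝ), IsOpenBall B → B ⊆ V → ∀ ε : ℝ, 0 < ε →
    volume {x | x ∈ B ∧ ‖f x‖ₑ < ENNReal.ofReal ε * ⨆ y ∈ B, ‖f y‖ₑ} ≤
      ENNReal.ofReal (C * ε ^ α) * volume B

/-- `f` is `l`-non-degenerate at `u`: it is `l` times continuously differentiable on a ball
centred at `u`, and its partial derivatives at `u` of orders `1, ..., l` span `ℝ^n`. -/
def NondegenerateAt {m n : ℕ} (l : ℕ) (f : (Fin m → ℝ) → (Fin n → ℝ)) (u : Fin m → ℝ) : Prop :=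
  (∃ r : ℝ, 0 < r ∧ ContDiffOn ℝ l f (Metric.ball u r)) ∧
    Submodule.span ℝ
      {v | ∃ β : Fin m → ℕ, 0 < multiOrder β ∧ multiOrder β ≤ l ∧ multiDeriv β f u = v} = ⊤

end

/-! The heart is a criterion for one function `G` with values in a normed space,
`exists_isGoodOn_norm`: if on a small ball about `x₀` the derivatives of order at most `k` oscillate
by at most `η`, and one of them has norm at least `c` at `x₀`, then `‖G‖` is `(C, α)`-good whenever
`α * k ≤ 1`, with `η` and `C` independent of `G`. Part (a) takes `G` to be the function and `k = l`;
part (b) takes `G` to be its Fréchet derivative and `k = l - 1`. The stated exponents give `α * k =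
1 / m ≤ 1`.

To prove the criterion on a ball `B` of radius `s`, weight the `j`-th derivative by `s ^ j`. Since
the top derivative is almost constant, the mean value inequality makes the largest weighted
derivative comparable to one number `N` at all points of `B` (`ContDiffOn.exists_jet_size`). So `sup
‖G‖` is at most a constant times `N`, while near each point some weighted derivative stays above a
constant times `N`. Polarization produces a single direction in which this derivative is large, a
norming functional makes it scalar, and the one-dimensional bound
`volume_sublevel_le_of_le_abs_deriv`, integrated over parallel lines, controls the sublevel set near
that point. A number of such neighbourhoods independent of `B` covers `B`. No upper bound for `G`
enters, so additive constants are harmless.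

In (1), compactness gives a common oscillation bound and a small `Θ` uses up only part of `η` and
`c`. In (2), goodness is invariant under scaling; after division by the norm of the linear form,
non-degeneracy gives a uniform `c` and `θ` becomes a small perturbation at `x₀`. -/

/-- The iterated derivative of `f` along the vectors of a list, the head being the last direction
of differentiation. -/
noncomputable def listDeriv {E F : Type*} [NormedAddCommGroup E] [NormedSpace ℝ E]
    [NormedAddCommGroup F] [NormedSpace ℝ F] (f : E → F) : List E → E → F
  | [] => f
  | v :: ws => fun x => fderiv ℝ (listDeriv f ws) x v

/-! ### Symmetry of iterated directional derivatives. -/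

section ListDeriv

variable {E F : Type*} [NormedAddCommGroup E] [NormedSpace ℝ E]
  [NormedAddCommGroup F] [NormedSpace ℝ F] {f : E → F} {U : Set E} {l : ℕ}

theorem ContDiffOn.listDeriv (hU : IsOpen U) (hf : ContDiffOn ℝ l f U) (ws : List E) {k : ℕ}
    (hk : k + ws.length ≤ l) : ContDiffOn ℝ k (listDeriv f ws) U := by
  induction ws generalizing k with
  | nil => exact hf.of_le (by exact_mod_cast (by simpa using hk))
  | cons v ws ih =>
    have h1 : ContDiffOn ℝ ((k + 1 : ℕ) : WithTop ℕ∞) (_root_.listDeriv f ws) U :=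
      ih (by simp only [List.length_cons] at hk; omega)
    exact (h1.fderiv_of_isOpen hU (m := k) (by push_cast; exact le_rfl)).clm_apply contDiffOn_const

theorem ContDiffOn.differentiableAt_listDeriv (hU : IsOpen U) (hf : ContDiffOn ℝ l f U)
    {ws : List E} (hk : ws.length < l) {x : E} (hx : x ∈ U) :
    DifferentiableAt ℝ (_root_.listDeriv f ws) x :=
  ((hf.listDeriv hU ws (k := 1) (by omega)).contDiffAt (hU.mem_nhds hx)).differentiableAt
    (by simp)

theorem ContDiffOn.listDeriv_perm (hU : IsOpen U) (hf : ContDiffOn ℝ l f U) {ws ws' : List E}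
    (h : ws.Perm ws') (hl : ws.length ≤ l) {x : E} (hx : x ∈ U) :
    _root_.listDeriv f ws x = _root_.listDeriv f ws' x := by
  induction h generalizing x with
  | nil => rfl
  | cons v _ ih =>
    simp only [List.length_cons] at hl
    have : _root_.listDeriv f _ =ᶠ[nhds x] _root_.listDeriv f _ :=
      Filter.eventuallyEq_of_mem (hU.mem_nhds hx) fun y hy => ih (by omega) hy
    simp only [_root_.listDeriv, this.fderiv_eq]
  -- Exchanging the two outermost directions is the symmetry of the second derivative of `listDeriv
  -- f ws`, which is still `C²`.
  | swap v w ws =>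
    simp only [List.length_cons] at hl
    have h2 : ContDiffAt ℝ 2 (_root_.listDeriv f ws) x :=
      (hf.listDeriv hU ws (k := 2) (by omega)).contDiffAt (hU.mem_nhds hx)
    have hd : DifferentiableAt ℝ (fderiv ℝ (_root_.listDeriv f ws)) x :=
      (h2.fderiv_right (m := 1) (by norm_num)).differentiableAt (by simp)
    have key : ∀ a b : E, _root_.listDeriv f (a :: b :: ws) x
        = fderiv ℝ (fderiv ℝ (_root_.listDeriv f ws)) x a b := by
      intro a b
      change fderiv ℝ (fun y => fderiv ℝ (_root_.listDeriv f ws) y b) x a = _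
      rw [fderiv_clm_apply hd (by fun_prop)]
      simp
    rw [key, key]
    exact (h2.isSymmSndFDerivAt (by simp)).eq _ _
  | trans h1 _ ih1 ih2 =>
    exact (ih1 hl hx).trans (ih2 (h1.length_eq ▸ hl) hx)

theorem ContDiffOn.iteratedFDeriv_eq_listDeriv (hU : IsOpen U) (hf : ContDiffOn ℝ l f U) {j : ℕ}
    (hj : j ≤ l) (v : Fin j → E) {x : E} (hx : x ∈ U) :
    iteratedFDeriv ℝ j f x v = _root_.listDeriv f (List.ofFn v) x := by
  induction j generalizing x with
  | zero => simp [_root_.listDeriv]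
  | succ j ih =>
    have hd : DifferentiableAt ℝ (iteratedFDeriv ℝ j f) x :=
      (hf.contDiffAt (hU.mem_nhds hx)).differentiableAt_iteratedFDeriv (by exact_mod_cast hj)
    have : (fun y => iteratedFDeriv ℝ j f y (Fin.tail v)) =ᶠ[nhds x]
        _root_.listDeriv f (List.ofFn (Fin.tail v)) :=
      Filter.eventuallyEq_of_mem (hU.mem_nhds hx) fun y hy => ih (by omega) _ hy
    rw [hd.iteratedFDeriv_succ_apply_left', this.fderiv_eq, List.ofFn_succ]
    rfl

theorem ContDiffOn.iteratedFDeriv_apply_comp_perm (hU : IsOpen U) (hf : ContDiffOn ℝ l f U) {j : ℕ}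
    (hj : j ≤ l) (v : Fin j → E) (σ : Equiv.Perm (Fin j)) {x : E} (hx : x ∈ U) :
    iteratedFDeriv ℝ j f x (v ∘ σ) = iteratedFDeriv ℝ j f x v := by
  rw [hf.iteratedFDeriv_eq_listDeriv hU hj _ hx, hf.iteratedFDeriv_eq_listDeriv hU hj _ hx]
  exact hf.listDeriv_perm hU (σ.ofFn_comp_perm v) (by simpa using hj) hx

end ListDeriv

/-! ### Multiindex derivatives versus Fréchet derivatives. -/

section MultiDeriv

variable {m l : ℕ} {F : Type*} [NormedAddCommGroup F] [NormedSpace ℝ F]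
  {f : (Fin m → ℝ) → F} {U : Set (Fin m → ℝ)}

/-- The coordinate directions of the differentiations in `multiDeriv β`. -/
def multiWord {m : ℕ} (β : Fin m → ℕ) : List (Fin m) :=
  (List.finRange m).flatMap fun i => List.replicate (β i) i

theorem length_multiWord (β : Fin m → ℕ) : (multiWord β).length = multiOrder β := by
  simp [multiWord, multiOrder, List.length_flatMap, List.sum_ofFn, ← List.ofFn_eq_map]

theorem count_multiWord (β : Fin m → ℕ) (i : Fin m) : (multiWord β).count i = β i := by
  rw [multiWord, List.count_flatMap, ← List.ofFn_eq_map, List.sum_ofFn]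
  simp [List.count_replicate]

theorem ContDiffOn.iterate_partialDeriv_eqOn (hU : IsOpen U) (hf : ContDiffOn ℝ l f U)
    {g : (Fin m → ℝ) → F} {ws : List (Fin m → ℝ)} (hg : EqOn g (_root_.listDeriv f ws) U)
    (i : Fin m) {n : ℕ} (hn : n + ws.length ≤ l) :
    EqOn ((partialDeriv i)^[n] g)
      (_root_.listDeriv f (List.replicate n (Pi.single i 1) ++ ws)) U := by
  induction n with
  | zero => simpa using hg
  | succ n ih =>
    intro x hx
    have h1 := ih (by omega)
    rw [Function.iterate_succ_apply', partialDeriv,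
      (Filter.eventuallyEq_of_mem (hU.mem_nhds hx) h1).lineDeriv_eq,
      (hf.differentiableAt_listDeriv hU (by simp; omega) hx).lineDeriv_eq_fderiv]
    simp [List.replicate_succ, _root_.listDeriv]

theorem ContDiffOn.multiDeriv_eq_listDeriv (hU : IsOpen U) (hf : ContDiffOn ℝ l f U)
    {β : Fin m → ℕ} (hβ : multiOrder β ≤ l) {x : Fin m → ℝ} (hx : x ∈ U) :
    multiDeriv β f x =
      _root_.listDeriv f ((multiWord β).map fun i => Pi.single i (1 : ℝ)) x := by
  have key : ∀ L : List (Fin m), (L.flatMap fun i => List.replicate (β i) i).length ≤ l →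
      EqOn (L.foldr (fun i g => (partialDeriv i)^[β i] g) f)
        (_root_.listDeriv f
          ((L.flatMap fun i => List.replicate (β i) i).map fun i => Pi.single i (1 : ℝ))) U := by
    intro L
    induction L with
    | nil => intro _ x _; simp [_root_.listDeriv]
    | cons i L ih =>
      intro hL
      simp only [List.flatMap_cons, List.length_append, List.length_replicate] at hL
      have := hf.iterate_partialDeriv_eqOn hU (ih (by omega)) i (n := β i) (by simpa using hL)
      simpa using this
  exact key _ (by rw [← length_multiWord] at hβ; exact hβ) hx

theorem multiDeriv_eq_iteratedFDeriv (hU : IsOpen U)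
    {β : Fin m → ℕ} (hβ : multiOrder β ≤ l) {x : Fin m → ℝ} (hx : x ∈ U) :
    ∃ a : Fin (multiOrder β) → Fin m,
      ∀ (g : (Fin m → ℝ) → F), ContDiffOn ℝ l g U →
        multiDeriv β g x = iteratedFDeriv ℝ (multiOrder β) g x fun i => Pi.single (a i) 1 := by
  refine ⟨fun i => (multiWord β).get (i.cast (length_multiWord β).symm), fun g hg => ?_⟩
  rw [hg.multiDeriv_eq_listDeriv hU hβ hx, hg.iteratedFDeriv_eq_listDeriv hU hβ _ hx]
  congr 1
  apply List.ext_getElem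
  · simp [length_multiWord]
  · intro n h1 h2
    simp

theorem ContDiffOn.norm_multiDeriv_le (hU : IsOpen U) (hf : ContDiffOn ℝ l f U)
    {β : Fin m → ℕ} (hβ : multiOrder β ≤ l) {x : Fin m → ℝ} (hx : x ∈ U) :
    ‖multiDeriv β f x‖ ≤ ‖iteratedFDeriv ℝ (multiOrder β) f x‖ := by
  obtain ⟨a, ha⟩ := multiDeriv_eq_iteratedFDeriv (F := F) hU hβ hx
  rw [ha f hf]
  simpa [Pi.norm_single] using
    (iteratedFDeriv ℝ (multiOrder β) f x).le_opNorm fun i => Pi.single (a i) (1 : ℝ)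

theorem exists_multiDeriv_eq_iteratedFDeriv_single (hU : IsOpen U)
    {j : ℕ} (hj : j ≤ l) (a : Fin j → Fin m) {x : Fin m → ℝ} (hx : x ∈ U) :
    ∃ β : Fin m → ℕ, multiOrder β = j ∧ ∀ g : (Fin m → ℝ) → F, ContDiffOn ℝ l g U →
      multiDeriv β g x = iteratedFDeriv ℝ j g x (fun i => Pi.single (a i) 1) := by
  let β : Fin m → ℕ := fun i => (List.ofFn a).count i
  have hp : (List.ofFn a).Perm (multiWord β) := by
    rw [List.perm_iff_count]
    intro i
    rw [count_multiWord]
  have hβ : multiOrder β = j := by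
    rw [← length_multiWord, ← hp.length_eq, List.length_ofFn]
  refine ⟨β, hβ, fun g hg => Eq.symm ?_⟩
  rw [hg.multiDeriv_eq_listDeriv hU (hβ.le.trans hj) hx, hg.iteratedFDeriv_eq_listDeriv hU hj _ hx]
  refine hg.listDeriv_perm hU ?_ (by simpa using hj) hx
  have := hp.map fun i => (Pi.single i (1 : ℝ) : Fin m → ℝ)
  rwa [List.map_ofFn] at this

/-- Expanding every argument in the standard basis gives `m ^ j` terms. This is how bounds on
partial derivatives become bounds on Fréchet derivatives. -/
theorem ContinuousMultilinearMap.norm_le_of_forall_single {j : ℕ}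
    (T : ContinuousMultilinearMap ℝ (fun _ : Fin j => Fin m → ℝ) F) {b : ℝ} (hb : 0 ≤ b)
    (h : ∀ a : Fin j → Fin m, ‖T fun i => Pi.single (a i) 1‖ ≤ b) : ‖T‖ ≤ (m : ℝ) ^ j * b := by
  refine T.opNorm_le_bound (by positivity) fun v => ?_
  have hv : v = fun i => ∑ a, v i a • (Pi.single a (1 : ℝ) : Fin m → ℝ) := by
    ext i k
    simp [Finset.sum_apply, Pi.single_apply]
  conv_lhs => rw [hv, T.map_sum]
  calc _ ≤ ∑ a : Fin j → Fin m, b * ∏ i, ‖v i‖ := by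
        refine norm_sum_le_of_le _ fun a _ => ?_
        rw [T.map_smul_univ (fun i => v i (a i)), norm_smul, norm_prod, mul_comm]
        exact mul_le_mul (h a)
          (Finset.prod_le_prod (fun _ _ => norm_nonneg _) fun i _ => norm_le_pi_norm (v i) (a i))
          (by positivity) hb
    _ = _ := by simp; ring

theorem ContDiffOn.norm_iteratedFDeriv_le_of_multiDeriv (hU : IsOpen U) (hf : ContDiffOn ℝ l f U)
    {j : ℕ} (hj : j ≤ l) {x : Fin m → ℝ} (hx : x ∈ U) {b : ℝ} (hb : 0 ≤ b)
    (h : ∀ β : Fin m → ℕ, multiOrder β = j → ‖multiDeriv β f x‖ ≤ b) :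
    ‖iteratedFDeriv ℝ j f x‖ ≤ (m : ℝ) ^ j * b := by
  refine ContinuousMultilinearMap.norm_le_of_forall_single _ hb fun a => ?_
  obtain ⟨β, hβ, h1⟩ := exists_multiDeriv_eq_iteratedFDeriv_single (F := F) hU hj a hx
  rw [← h1 f hf]
  exact h β hβ

theorem ContDiffOn.norm_iteratedFDeriv_sub_le_of_multiDeriv (hU : IsOpen U)
    (hf : ContDiffOn ℝ l f U) {g : (Fin m → ℝ) → F} (hg : ContDiffOn ℝ l g U)
    {j : ℕ} (hj : j ≤ l) {x : Fin m → ℝ} (hx : x ∈ U) {b : ℝ} (hb : 0 ≤ b)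
    (h : ∀ β : Fin m → ℕ, multiOrder β = j → ‖multiDeriv β f x - multiDeriv β g x‖ ≤ b) :
    ‖iteratedFDeriv ℝ j f x - iteratedFDeriv ℝ j g x‖ ≤ (m : ℝ) ^ j * b := by
  refine ContinuousMultilinearMap.norm_le_of_forall_single _ hb fun a => ?_
  obtain ⟨β, hβ, h1⟩ := exists_multiDeriv_eq_iteratedFDeriv_single (F := F) hU hj a hx
  rw [sub_apply, ← h1 f hf, ← h1 g hg]
  exact h β hβ

end MultiDeriv

/-! ### Polarization: diagonal values control symmetric multilinear maps. -/

section Polarization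

variable {E F : Type*} [NormedAddCommGroup E] [NormedSpace ℝ E]
  [NormedAddCommGroup F] [NormedSpace ℝ F]

/-- Inclusion-exclusion: the complements of the sets `S ⊇ R` run through the subsets of `Rᶜ`, whose
alternating sum vanishes unless `Rᶜ` is empty. -/
theorem sum_powerset_neg_one_pow_of_subset {j : ℕ} (R : Finset (Fin j)) :
    ∑ S : Finset (Fin j), (if R ⊆ S then (-1 : ℝ) ^ (Sᶜ).card else 0)
      = if R = Finset.univ then 1 else 0 := by
  have h1 : ∑ S : Finset (Fin j), (if R ⊆ S then (-1 : ℝ) ^ (Sᶜ).card else 0)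
      = ∑ S : Finset (Fin j), (if S ⊆ Rᶜ then (-1 : ℝ) ^ S.card else 0) := by
    refine Fintype.sum_equiv (Equiv.ofBijective compl compl_bijective) _ _ fun S => ?_
    simp [Equiv.ofBijective_apply]
  rw [h1, ← Finset.sum_filter]
  have h2 : Finset.univ.filter (fun S : Finset (Fin j) => S ⊆ Rᶜ) = (Rᶜ).powerset := by
    ext S; simp
  have h3 := Finset.sum_powerset_neg_one_pow_card (x := Rᶜ)
  rw [h2]
  have h4 := congrArg (Int.cast : ℤ → ℝ) h3
  push_cast at h4
  rw [h4]
  simp [Finset.compl_eq_empty_iff]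

/-- The polarization formula for symmetric multilinear maps. -/
theorem ContinuousMultilinearMap.polarization {j : ℕ}
    (T : ContinuousMultilinearMap ℝ (fun _ : Fin j => E) F) (v : Fin j → E)
    (hT : ∀ σ : Equiv.Perm (Fin j), T (v ∘ σ) = T v) :
    ∑ S : Finset (Fin j), (-1 : ℝ) ^ (Sᶜ).card • T (fun _ => ∑ i ∈ S, v i)
      = (j.factorial : ℝ) • T v := by
  have h1 : ∀ S : Finset (Fin j), T (fun _ => ∑ i ∈ S, v i)
      = ∑ a : Fin j → Fin j, if Finset.univ.image a ⊆ S then T (v ∘ a) else 0 := by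
    intro S
    rw [T.map_sum_finset, ← Finset.sum_filter]
    refine Finset.sum_congr ?_ fun _ _ => rfl
    ext a
    simp [Fintype.mem_piFinset, Finset.subset_iff]
  simp_rw [h1, Finset.smul_sum]
  rw [Finset.sum_comm]
  -- After summation over `S`, only the index functions `a` with full image survive; these are the
  -- permutations, and each contributes `T v` by symmetry.
  have h2 : ∀ a : Fin j → Fin j,
      ∑ S : Finset (Fin j), (-1 : ℝ) ^ (Sᶜ).card •
        (if Finset.univ.image a ⊆ S then T (v ∘ a) else 0)
      = if Function.Bijective a then T v else 0 := by
    intro a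
    have h3 : ∀ S : Finset (Fin j), (-1 : ℝ) ^ (Sᶜ).card •
        (if Finset.univ.image a ⊆ S then T (v ∘ a) else 0)
        = (if Finset.univ.image a ⊆ S then (-1 : ℝ) ^ (Sᶜ).card else 0) • T (v ∘ a) := by
      intro S; split_ifs <;> simp
    simp_rw [h3]
    rw [← Finset.sum_smul, sum_powerset_neg_one_pow_of_subset]
    have h4 : Finset.univ.image a = Finset.univ ↔ Function.Bijective a := by
      rw [← Finite.surjective_iff_bijective]
      simp [Finset.eq_univ_iff_forall, Function.Surjective]
    simp only [h4]
    split_ifs with h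
    · rw [one_smul]; exact hT (Equiv.ofBijective a h)
    · simp
  simp_rw [h2]
  rw [← Finset.sum_filter, Finset.sum_const]
  have h5 : (Finset.univ.filter fun a : Fin j → Fin j => Function.Bijective a).card
      = j.factorial := by
    rw [← Fintype.card_subtype, Fintype.card_congr Equiv.bijectiveEquiv, Fintype.card_perm,
      Fintype.card_fin]
  rw [h5, Nat.cast_smul_eq_nsmul]

/-- For unit vectors, polarization writes `j! • T u` as a signed sum of `2 ^ j` diagonal values at
vectors of norm at most `j`, each at most `j ^ j * b` by homogeneity; the factor `j! ≥ 1` is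
discarded. -/
theorem ContinuousMultilinearMap.norm_le_of_forall_diagonal {j : ℕ}
    (T : ContinuousMultilinearMap ℝ (fun _ : Fin j => E) F)
    (hT : ∀ (v : Fin j → E) (σ : Equiv.Perm (Fin j)), T (v ∘ σ) = T v) {b : ℝ}
    (h : ∀ v : E, ‖v‖ ≤ 1 → ‖T fun _ => v‖ ≤ b) :
    ‖T‖ ≤ 2 ^ j * (j : ℝ) ^ j * b := by
  have hb : 0 ≤ b := (norm_nonneg _).trans (h 0 (by simp))
  have hdiag : ∀ v : E, ∀ r : ℝ, 0 ≤ r → ‖v‖ ≤ r → ‖T fun _ => v‖ ≤ r ^ j * b := by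
    intro v r hr hv
    rcases hr.eq_or_lt with rfl | hr
    · have : v = 0 := by simpa using hv
      subst this
      rcases j with _ | j
      · simpa using h 0 (by simp)
      · have : (T fun _ => (0 : E)) = 0 := T.map_coord_zero 0 rfl
        simp [this]
    · have h1 : (T fun _ => v) = r ^ j • T fun _ => r⁻¹ • v := by
        have := T.map_smul_univ (fun _ : Fin j => r) fun _ => r⁻¹ • v
        simpa [smul_smul, hr.ne'] using this
      rw [h1, norm_smul, norm_pow, Real.norm_of_nonneg hr.le]
      gcongr
      refine h _ ?_
      rw [norm_smul, norm_inv, Real.norm_of_nonneg hr.le, inv_mul_le_iff₀ hr]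
      simpa using hv
  have hunit : ∀ u : Fin j → E, (∀ i, ‖u i‖ ≤ 1) → ‖T u‖ ≤ 2 ^ j * (j : ℝ) ^ j * b := by
    intro u hu
    have h1 : (1 : ℝ) ≤ j.factorial := by exact_mod_cast Nat.one_le_iff_ne_zero.2 j.factorial_ne_zero
    calc ‖T u‖ ≤ j.factorial * ‖T u‖ := le_mul_of_one_le_left (norm_nonneg _) h1
      _ = ‖(j.factorial : ℝ) • T u‖ := by rw [norm_smul]; simp
      _ ≤ ∑ _S : Finset (Fin j), (j : ℝ) ^ j * b := by
          rw [← T.polarization u (hT u)]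
          refine norm_sum_le_of_le _ fun S _ => ?_
          rw [norm_smul, norm_pow, norm_neg, norm_one, one_pow, one_mul]
          refine hdiag _ _ (by positivity) ((norm_sum_le_of_le _ fun i _ => hu i).trans ?_)
          rw [Finset.sum_const, nsmul_eq_mul, mul_one]
          exact_mod_cast (Finset.card_le_univ S).trans (by simp)
      _ = _ := by simp; ring
  refine T.opNorm_le_bound (by positivity) fun u => ?_
  by_cases hz : ∃ i, u i = 0
  · obtain ⟨i, hi⟩ := hz
    rw [T.map_coord_zero i hi, norm_zero]
    positivity
  · push Not at hz
    have h1 := T.map_smul_univ (fun i => ‖u i‖) fun i => ‖u i‖⁻¹ • u i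
    have h2 : (fun i => ‖u i‖ • ‖u i‖⁻¹ • u i) = u := by
      ext i
      rw [smul_smul, mul_inv_cancel₀ (norm_ne_zero_iff.2 (hz i)), one_smul]
    rw [h2] at h1
    rw [h1, norm_smul, norm_prod, mul_comm]
    simp only [norm_norm]
    gcongr
    refine hunit _ fun i => ?_
    rw [norm_smul, norm_inv, norm_norm, inv_mul_cancel₀ (norm_ne_zero_iff.2 (hz i))]

end Polarization

/-! ### One-dimensional sublevel estimates and integration along lines. -/

section Sublevel

/-- By Darboux's theorem a derivative without zeros has constant sign, even if it is not continuous.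
-/
theorem Convex.monotoneOn_or_antitoneOn_of_hasDerivAt_ne_zero {I : Set ℝ} (hI : Convex ℝ I)
    {h h' : ℝ → ℝ} (hh : ∀ s ∈ I, HasDerivAt h (h' s) s) (h0 : ∀ s ∈ I, h' s ≠ 0) :
    MonotoneOn h I ∨ AntitoneOn h I := by
  have hc : ContinuousOn h I := fun s hs => (hh s hs).continuousAt.continuousWithinAt
  rcases hasDerivWithinAt_forall_lt_or_forall_gt_of_forall_ne hI
    (fun s hs => (hh s hs).hasDerivWithinAt) h0 with hlt | hgt
  · exact Or.inr (antitoneOn_of_hasDerivWithinAt_nonpos hI hc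
      (fun s hs => (hh s (interior_subset hs)).hasDerivWithinAt)
      fun s hs => (hlt s (interior_subset hs)).le)
  · exact Or.inl (monotoneOn_of_hasDerivWithinAt_nonneg hI hc
      (fun s hs => (hh s (interior_subset hs)).hasDerivWithinAt)
      fun s hs => (hgt s (interior_subset hs)).le)

/-- By the mean value theorem, two points where `|h| < lam * mu` are at distance at most `2 * mu`,
so the diameter already bounds the measure. -/
theorem volume_abs_lt_le_of_le_abs_deriv {I : Set ℝ} (hI : Convex ℝ I)
    {h h' : ℝ → ℝ} (hh : ∀ s ∈ I, HasDerivAt h (h' s) s) {lam mu : ℝ} (hlam : 0 < lam)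
    (h0 : ∀ s ∈ I, lam ≤ |h' s|) :
    volume {s | s ∈ I ∧ |h s| < lam * mu} ≤ ENNReal.ofReal (2 * mu) := by
  refine (Real.volume_le_diam _).trans (Metric.ediam_le fun x hx y hy => ?_)
  rw [edist_dist]
  refine ENNReal.ofReal_le_ofReal ?_
  wlog hxy : x < y generalizing x y
  · rcases (not_lt.1 hxy).eq_or_lt with rfl | hlt
    · rw [dist_self]
      have : 0 < lam * mu := (abs_nonneg _).trans_lt hx.2
      nlinarith [pos_of_mul_pos_right this hlam.le]
    · rw [dist_comm]; exact this y hy x hx hlt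
  have hsub : Icc x y ⊆ I := hI.ordConnected.out hx.1 hy.1
  obtain ⟨ξ, hξ, hs⟩ := exists_hasDerivAt_eq_slope h h' hxy
    (fun s hs => (hh s (hsub hs)).continuousAt.continuousWithinAt)
    fun s hs => hh s (hsub (Ioo_subset_Icc_self hs))
  have h1 := h0 ξ (hsub (Ioo_subset_Icc_self hξ))
  have hpos : 0 < y - x := sub_pos.2 hxy
  rw [hs, abs_div, abs_of_pos hpos, le_div_iff₀ hpos] at h1
  have h2 : |h y - h x| < lam * (2 * mu) := by
    have := abs_sub (h y) (h x)
    linarith [hx.2, hy.2]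
  rw [dist_comm, Real.dist_eq, abs_of_pos hpos]
  exact (lt_of_mul_lt_mul_left (h1.trans_lt h2) hlam.le).le

/-- If the `j`-th derivative of a function on an interval is bounded from below, then the
sublevel sets of the function are small. -/
theorem volume_sublevel_le_of_le_abs_deriv (j : ℕ) {g : ℕ → ℝ → ℝ} {I : Set ℝ} (hI : Convex ℝ I)
    (hg : ∀ i < j, ∀ s ∈ I, HasDerivAt (g i) (g (i + 1) s) s) {lam t : ℝ} (hlam : 0 < lam)
    (ht : 0 < t) (hl : ∀ s ∈ I, lam ≤ |g j s|) :
    volume {s | s ∈ I ∧ |g 0 s| < lam * t ^ j} ≤ ENNReal.ofReal ((2 ^ (j + 1) - 2) * t) := by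
  induction j generalizing I lam with
  | zero =>
    have : {s | s ∈ I ∧ |g 0 s| < lam * t ^ 0} = ∅ := by
      ext s
      simp only [pow_zero, mul_one, mem_ofPred_eq, mem_empty_iff_false, iff_false, not_and, not_lt]
      exact hl s
    rw [this]; simp
  -- Since `g j` is monotone, the set where `|g j| < lam * t` is short and its complement in `I`
  -- consists of two intervals on which the induction hypothesis applies with `lam * t`. The
  -- constants satisfy `a (j + 1) = 2 * a j + 2` with `a 0 = 0`, hence `a j = 2 ^ (j + 1) - 2`.
  | succ j ih =>
    have hj := hg j (by omega)
    have hmono := hI.monotoneOn_or_antitoneOn_of_hasDerivAt_ne_zero hj fun s hs h0 => by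
      have := hl s hs
      rw [h0, abs_zero] at this
      linarith
    have hoc := hI.ordConnected
    have hc1 : Convex ℝ {s | s ∈ I ∧ lam * t ≤ g j s} := by
      refine OrdConnected.convex ⟨fun x hx y hy z hz => ?_⟩
      have hzI := hoc.out hx.1 hy.1 hz
      rcases hmono with h | h
      · exact ⟨hzI, hx.2.trans (h hx.1 hzI hz.1)⟩
      · exact ⟨hzI, hy.2.trans (h hzI hy.1 hz.2)⟩
    have hc2 : Convex ℝ {s | s ∈ I ∧ g j s ≤ -(lam * t)} := by
      refine OrdConnected.convex ⟨fun x hx y hy z hz => ?_⟩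
      have hzI := hoc.out hx.1 hy.1 hz
      rcases hmono with h | h
      · exact ⟨hzI, (h hzI hy.1 hz.2).trans hy.2⟩
      · exact ⟨hzI, (h hx.1 hzI hz.1).trans hx.2⟩
    have hlt : 0 < lam * t := by positivity
    have e1 := ih hc1 (fun i hi s hs => hg i (by omega) s hs.1) hlt
      fun s hs => hs.2.trans (le_abs_self _)
    have e2 := ih hc2 (fun i hi s hs => hg i (by omega) s hs.1) hlt
      fun s hs => (le_neg_of_le_neg hs.2).trans (neg_le_abs _)
    have e3 := volume_abs_lt_le_of_le_abs_deriv (mu := t) hI hj hlam hl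
    have hsub : {s | s ∈ I ∧ |g 0 s| < lam * t ^ (j + 1)} ⊆
        ({s | s ∈ {s | s ∈ I ∧ lam * t ≤ g j s} ∧ |g 0 s| < lam * t * t ^ j} ∪
        {s | s ∈ {s | s ∈ I ∧ g j s ≤ -(lam * t)} ∧ |g 0 s| < lam * t * t ^ j}) ∪
        {s | s ∈ I ∧ |g j s| < lam * t} := by
      rintro s ⟨hs, h⟩
      rw [pow_succ', ← mul_assoc] at h
      by_cases h1 : lam * t ≤ g j s
      · exact Or.inl (Or.inl ⟨⟨hs, h1⟩, h⟩)
      · by_cases h2 : g j s ≤ -(lam * t)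
        · exact Or.inl (Or.inr ⟨⟨hs, h2⟩, h⟩)
        · exact Or.inr ⟨hs, abs_lt.2 ⟨not_le.1 h2, not_le.1 h1⟩⟩
    refine (measure_mono hsub).trans ((measure_union_le _ _).trans
      ((add_le_add ((measure_union_le _ _).trans (add_le_add e1 e2)) e3).trans ?_))
    have hpow : (2 : ℝ) ≤ 2 ^ (j + 1) := by
      rw [pow_succ]; linarith [one_le_pow₀ (M₀ := ℝ) (a := 2) (by norm_num) (n := j)]
    rw [← ENNReal.ofReal_add (by nlinarith) (by nlinarith), ← ENNReal.ofReal_add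
      (by nlinarith) (by nlinarith)]
    refine ENNReal.ofReal_le_ofReal (le_of_eq ?_)
    ring

/-- A bounded set whose sections along a direction are small is small. -/
theorem ofReal_mul_volume_le_of_sections {m : ℕ} {S : Set (Fin m → ℝ)} (hS : MeasurableSet S)
    {p v : Fin m → ℝ} {R : ℝ} (hSR : S ⊆ Metric.ball p R) (hv : ‖v‖ ≤ 1) {M : ℝ≥0∞}
    (hM : ∀ x, volume {t : ℝ | x + t • v ∈ S} ≤ M) :
    ENNReal.ofReal R * volume S ≤ M * volume (Metric.ball p (2 * R)) := by
  have hmeas : Measurable fun q : (Fin m → ℝ) × ℝ => S.indicator (1 : (Fin m → ℝ) → ℝ≥0∞)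
      (q.1 + q.2 • v) :=
    (measurable_one.indicator hS).comp (by fun_prop)
  -- Averaging over translations by `t • v`, `0 ≤ t ≤ R`, replaces a change of coordinates adapted
  -- to `v`. In one order the integral is `R * volume S` by translation invariance; in the other
  -- only `x` in the ball of radius `2 * R` contribute, each at most `M`.
  have h1 : ∫⁻ x : Fin m → ℝ, ∫⁻ t in Icc 0 R, S.indicator (1 : (Fin m → ℝ) → ℝ≥0∞) (x + t • v)
      = ENNReal.ofReal R * volume S := by
    rw [lintegral_lintegral_swap hmeas.aemeasurable]
    have : ∀ t : ℝ, ∫⁻ x : Fin m → ℝ, S.indicator (1 : (Fin m → ℝ) → ℝ≥0∞) (x + t • v)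
        = volume S := by
      intro t
      rw [lintegral_add_right_eq_self (S.indicator (1 : (Fin m → ℝ) → ℝ≥0∞)) (t • v),
        lintegral_indicator_one hS]
    simp_rw [this]
    rw [lintegral_const, Measure.restrict_apply_univ, Real.volume_Icc, sub_zero, mul_comm]
  rw [← h1, ← lintegral_indicator_const Metric.isOpen_ball.measurableSet]
  refine lintegral_mono fun x => ?_
  have h2 : ∀ t, S.indicator (1 : (Fin m → ℝ) → ℝ≥0∞) (x + t • v)
      = {t : ℝ | x + t • v ∈ S}.indicator 1 t := fun t => rfl
  simp_rw [h2]
  by_cases hx : x ∈ Metric.ball p (2 * R)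
  · rw [indicator_of_mem hx]
    have hm : MeasurableSet {t : ℝ | x + t • v ∈ S} :=
      (by fun_prop : Measurable fun t : ℝ => x + t • v) hS
    rw [lintegral_indicator_one hm]
    exact (Measure.restrict_apply_le _ _).trans (hM x)
  · rw [indicator_of_notMem hx, nonpos_iff_eq_zero]
    refine (setLIntegral_congr_fun (g := 0) measurableSet_Icc fun t ht => ?_).trans (by simp)
    refine indicator_of_notMem (fun h => hx ?_) _
    have h3 := hSR h
    rw [mem_ball_iff_norm] at h3 ⊢
    have h4 : ‖t • v‖ ≤ R := by
      rw [norm_smul, Real.norm_of_nonneg ht.1]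
      exact (mul_le_mul ht.2 hv (norm_nonneg _) (ht.1.trans ht.2)).trans (mul_one R).le
    calc ‖x - p‖ = ‖(x + t • v - p) - t • v‖ := by congr 1; abel
      _ ≤ _ := norm_sub_le _ _
      _ < 2 * R := by linarith

end Sublevel

/-! ### Weighted jets on a ball of radius comparable to `s`. -/

section Jets

variable {E W : Type*} [NormedAddCommGroup E] [NormedSpace ℝ E]
  [NormedAddCommGroup W] [NormedSpace ℝ W] {G : E → W} {B : Set E} {k : ℕ} {s : ℝ}

theorem ContDiffOn.differentiableAt_iteratedFDeriv (hB : IsOpen B) (hG : ContDiffOn ℝ k G B) {j : ℕ}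
    (hj : j < k) {x : E} (hx : x ∈ B) : DifferentiableAt ℝ (iteratedFDeriv ℝ j G) x :=
  (hG.contDiffAt (hB.mem_nhds hx)).differentiableAt_iteratedFDeriv (by exact_mod_cast hj)

/-- The mean value inequality in scale-invariant form: over a distance `ρ * s`, the weighted
derivative of order `j` varies by at most `ρ` times the bound for order `j + 1`. -/
theorem ContDiffOn.pow_mul_norm_iteratedFDeriv_sub_le (hB : IsOpen B) (hc : Convex ℝ B)
    (hG : ContDiffOn ℝ k G B) (hs : 0 < s) {j : ℕ} (hj : j < k) {b : ℝ}
    (hb : ∀ x ∈ B, s ^ (j + 1) * ‖iteratedFDeriv ℝ (j + 1) G x‖ ≤ b) {x y : E} (hx : x ∈ B)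
    (hy : y ∈ B) {ρ : ℝ} (hxy : ‖y - x‖ ≤ ρ * s) :
    s ^ j * ‖iteratedFDeriv ℝ j G y - iteratedFDeriv ℝ j G x‖ ≤ ρ * b := by
  have hpos : 0 < s ^ (j + 1) := by positivity
  have hb0 : 0 ≤ b := (by positivity : (0 : ℝ) ≤ _).trans (hb x hx)
  have h1 := hc.norm_image_sub_le_of_norm_fderiv_le (𝕜 := ℝ) (f := iteratedFDeriv ℝ j G)
    (C := b / s ^ (j + 1)) (fun z hz => hG.differentiableAt_iteratedFDeriv hB hj hz)
    (fun z hz => by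
      rw [norm_fderiv_iteratedFDeriv, le_div_iff₀ hpos, mul_comm]
      exact hb z hz) hx hy
  calc _ ≤ s ^ j * (b / s ^ (j + 1) * (ρ * s)) := by
        gcongr
        exact h1.trans (by gcongr)
    _ = ρ * b := by rw [pow_succ]; field_simp

/-- Growth of the derivatives of a function whose top derivative is almost constant. -/
theorem ContDiffOn.pow_mul_norm_iteratedFDeriv_le (hB : IsOpen B) (hc : Convex ℝ B)
    (hG : ContDiffOn ℝ k G B) (hs : 0 < s) (hdiam : ∀ x ∈ B, ∀ y ∈ B, ‖y - x‖ ≤ 2 * s) {x : E}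
    (hx : x ∈ B) {a : ℝ} (ha : ∀ j ≤ k, s ^ j * ‖iteratedFDeriv ℝ j G x‖ ≤ a)
    (hosc : ∀ y ∈ B, s ^ k * ‖iteratedFDeriv ℝ k G y - iteratedFDeriv ℝ k G x‖ ≤ a) {j : ℕ}
    (hj : j ≤ k) {y : E} (hy : y ∈ B) :
    s ^ j * ‖iteratedFDeriv ℝ j G y‖ ≤ 2 * 3 ^ k * a := by
  have ha0 : 0 ≤ a := (by positivity : (0 : ℝ) ≤ _).trans (ha 0 (Nat.zero_le _))
  have tri : ∀ (j : ℕ) (y : E), s ^ j * ‖iteratedFDeriv ℝ j G y‖ ≤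
      s ^ j * ‖iteratedFDeriv ℝ j G x‖ +
        s ^ j * ‖iteratedFDeriv ℝ j G y - iteratedFDeriv ℝ j G x‖ := by
    intro j y
    rw [← mul_add]
    gcongr
    exact norm_le_norm_add_norm_sub' _ _
  -- Descending induction on the order `j = k - i`: a bound for order `j + 1` controls the variation
  -- of order `j` over the diameter `2 * s`, and `a + 2 * (2 * 3 ^ i * a) ≤ 2 * 3 ^ (i + 1) * a`.
  have key : ∀ i j : ℕ, i + j = k → ∀ y ∈ B,
      s ^ j * ‖iteratedFDeriv ℝ j G y‖ ≤ 2 * 3 ^ i * a := by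
    intro i
    induction i with
    | zero =>
      intro j hij y hy
      obtain rfl : j = k := by omega
      linarith [tri j y, ha j le_rfl, hosc y hy]
    | succ i ih =>
      intro j hij y hy
      have h1 := hG.pow_mul_norm_iteratedFDeriv_sub_le hB hc hs (by omega) (ih (j + 1) (by omega))
        hx hy (hdiam x hx y hy)
      have h2 : a ≤ 3 ^ i * a := le_mul_of_one_le_left ha0 (one_le_pow₀ (by norm_num))
      rw [pow_succ]
      linarith [tri j y, ha j (by omega)]
  refine (key (k - j) j (by omega) y hy).trans ?_
  gcongr
  · norm_num
  · omega

/-- The weighted jets of a function with almost constant top derivative have comparable sizes at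
all points. -/
theorem ContDiffOn.exists_jet_size (hB : IsOpen B) (hc : Convex ℝ B)
    (hG : ContDiffOn ℝ k G B) (hs : 0 < s) (hs1 : s ≤ 1)
    (hdiam : ∀ x ∈ B, ∀ y ∈ B, ‖y - x‖ ≤ 2 * s) {z : E} (hz : z ∈ B) {b ω : ℝ} (hb : 0 < b)
    (hωb : ω ≤ b) (hosc : ∀ x ∈ B, ∀ y ∈ B, ‖iteratedFDeriv ℝ k G y - iteratedFDeriv ℝ k G x‖ ≤ ω)
    (hlow : ∀ x ∈ B, ∃ j ≤ k, b ≤ ‖iteratedFDeriv ℝ j G x‖) :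
    ∃ N : ℝ, 0 < N ∧ s ^ k * b ≤ N ∧
      (∀ y ∈ B, ∀ j ≤ k, s ^ j * ‖iteratedFDeriv ℝ j G y‖ ≤ 2 * 3 ^ k * N) ∧
      ∀ y ∈ B, ∃ j ≤ k, N ≤ 2 * 3 ^ k * (s ^ j * ‖iteratedFDeriv ℝ j G y‖) := by
  have hmax : ∀ x : E, ∃ j ≤ k, ∀ i ≤ k, s ^ i * ‖iteratedFDeriv ℝ i G x‖ ≤
      s ^ j * ‖iteratedFDeriv ℝ j G x‖ := by
    intro x
    obtain ⟨j, hj, h⟩ := (Finset.range (k + 1)).exists_max_image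
      (fun j => s ^ j * ‖iteratedFDeriv ℝ j G x‖) ⟨0, by simp⟩
    exact ⟨j, by simpa [Nat.lt_succ_iff] using hj,
      fun i hi => h i (by simpa [Nat.lt_succ_iff] using hi)⟩
  -- As `s ≤ 1`, the lower bound `b` forces `s ^ k * b ≤ a`, so the oscillation of the top
  -- derivative is absorbed in `a`. Then `N` is the largest weighted derivative at `z`, and
  -- exchanging the roles of `z` and `y` gives the reverse comparison.
  have hgrow : ∀ x ∈ B, ∀ a : ℝ, (∀ i ≤ k, s ^ i * ‖iteratedFDeriv ℝ i G x‖ ≤ a) →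
      s ^ k * b ≤ a ∧ ∀ y ∈ B, ∀ j ≤ k, s ^ j * ‖iteratedFDeriv ℝ j G y‖ ≤ 2 * 3 ^ k * a := by
    intro x hx a ha
    have h1 : s ^ k * b ≤ a := by
      obtain ⟨j, hj, h⟩ := hlow x hx
      refine le_trans ?_ (ha j hj)
      exact mul_le_mul (pow_le_pow_of_le_one hs.le hs1 hj) h hb.le (by positivity)
    refine ⟨h1, fun y hy j hj => hG.pow_mul_norm_iteratedFDeriv_le hB hc hs hdiam hx ha
      (fun y hy => ?_) hj hy⟩
    refine le_trans ?_ h1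
    gcongr
    exact (hosc x hx y hy).trans hωb
  obtain ⟨j, hj, h⟩ := hmax z
  obtain ⟨h1, h2⟩ := hgrow z hz _ h
  refine ⟨_, (by positivity : 0 < s ^ k * b).trans_le h1, h1, h2, fun y hy => ?_⟩
  obtain ⟨i, hi, h'⟩ := hmax y
  exact ⟨i, hi, (hgrow y hy _ h').2 z hz j hj⟩

/-- If no `v` worked, polarization would bound the norm of the derivative by half of itself. The
base `k + 1` instead of `k` makes the constant monotone in the exponent, so that one `P` serves all
`j ≤ k`. -/
theorem ContDiffOn.exists_diagonal_lower_bound (hB : IsOpen B) (hG : ContDiffOn ℝ k G B) {j : ℕ}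
    (hj : j ≤ k) {y : E} (hy : y ∈ B) {P : ℝ} (hP : 2 ^ k * ((k : ℝ) + 1) ^ k ≤ P) :
    ∃ v : E, ‖v‖ ≤ 1 ∧
      ‖iteratedFDeriv ℝ j G y‖ ≤ 2 * P * ‖iteratedFDeriv ℝ j G y fun _ => v‖ := by
  have hP0 : 0 < P := lt_of_lt_of_le (by positivity) hP
  rcases (norm_nonneg (iteratedFDeriv ℝ j G y)).eq_or_lt with h0 | h0
  · exact ⟨0, by simp, by rw [← h0]; positivity⟩
  by_contra! hcon
  have h1 := (iteratedFDeriv ℝ j G y).norm_le_of_forall_diagonal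
    (fun v σ => hG.iteratedFDeriv_apply_comp_perm hB hj v σ hy)
    (b := ‖iteratedFDeriv ℝ j G y‖ / (2 * P)) fun v hv => by
      rw [le_div_iff₀ (by positivity), mul_comm]
      exact (hcon v hv).le
  have h2 : (2 : ℝ) ^ j * (j : ℝ) ^ j ≤ P := by
    refine le_trans ?_ hP
    have hjk : (j : ℝ) ≤ k := by exact_mod_cast hj
    have : (j : ℝ) ^ j ≤ ((k : ℝ) + 1) ^ k :=
      (pow_le_pow_left₀ (by positivity) (by linarith) j).trans
        (pow_le_pow_right₀ (by linarith [(Nat.cast_nonneg k : (0 : ℝ) ≤ k)]) hj)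
    gcongr
    norm_num
  have h3 : ‖iteratedFDeriv ℝ j G y‖ ≤ P * (‖iteratedFDeriv ℝ j G y‖ / (2 * P)) :=
    h1.trans (by gcongr)
  have h4 : P * (‖iteratedFDeriv ℝ j G y‖ / (2 * P)) = ‖iteratedFDeriv ℝ j G y‖ / 2 := by
    field_simp
  linarith

theorem ContDiffOn.hasDerivAt_iteratedFDeriv_line (hB : IsOpen B) (hG : ContDiffOn ℝ k G B) {j : ℕ}
    (hj : j < k) {x v : E} {t : ℝ} (hx : x + t • v ∈ B) (φ : W →L[ℝ] ℝ) :
    HasDerivAt (fun t : ℝ => φ (iteratedFDeriv ℝ j G (x + t • v) fun _ => v))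
      (φ (iteratedFDeriv ℝ (j + 1) G (x + t • v) fun _ => v)) t := by
  have h1 := (hG.differentiableAt_iteratedFDeriv hB hj hx).hasFDerivAt
  have h2 : HasDerivAt (fun t : ℝ => x + t • v) v t := by
    simpa using ((hasDerivAt_id t).smul_const v).const_add x
  have h3 := h1.comp_hasDerivAt t h2
  have h4 := ((ContinuousMultilinearMap.apply ℝ (fun _ : Fin j => E) W fun _ => v).hasFDerivAt
    (x := iteratedFDeriv ℝ j G (x + t • v))).comp_hasDerivAt t h3
  exact (φ.hasFDerivAt (x := iteratedFDeriv ℝ j G (x + t • v) fun _ => v)).comp_hasDerivAt t h4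

end Jets

/-! ### Sublevel sets near a point, and covering. -/

section Core

variable {m k : ℕ} {W : Type*} [NormedAddCommGroup W] [NormedSpace ℝ W]
  {G : (Fin m → ℝ) → W} {B : Set (Fin m → ℝ)} {s : ℝ}

/-- If a weighted derivative of order `j` is large at `y` and varies little near `y`, then the
sublevel sets near `y` are small. -/
theorem ContDiffOn.volume_sublevel_inter_ball_le (hB : IsOpen B) (hc : Convex ℝ B)
    (hG : ContDiffOn ℝ k G B) (hs : 0 < s) {j : ℕ} (hj : j ≤ k) {y : Fin m → ℝ} (hy : y ∈ B)
    {P : ℝ} (hP : 2 ^ k * ((k : ℝ) + 1) ^ k ≤ P) {q ρ : ℝ} (hq : 0 < q) (hρ : 0 < ρ)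
    (hlow : 4 * P * q ≤ s ^ j * ‖iteratedFDeriv ℝ j G y‖)
    (hosc : ∀ x ∈ B ∩ Metric.ball y (ρ * s),
      s ^ j * ‖iteratedFDeriv ℝ j G x - iteratedFDeriv ℝ j G y‖ ≤ q)
    {σ : ℝ} (hσ : 0 < σ) (hσ1 : σ ≤ 1) :
    volume {x | x ∈ B ∩ Metric.ball y (ρ * s) ∧ ‖G x‖ < q * σ ^ k} ≤
      ENNReal.ofReal (2 ^ (k + 1) * σ / ρ * (4 * (ρ * s)) ^ m) := by
  have hP0 : 0 < P := lt_of_lt_of_le (by positivity) hP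
  obtain ⟨v, hv, hdiag⟩ := hG.exists_diagonal_lower_bound hB hj hy hP
  obtain ⟨φ, hφ, hφv⟩ := exists_dual_vector'' ℝ (iteratedFDeriv ℝ j G y fun _ => v)
  simp only [RCLike.ofReal_real_eq_id, id_eq] at hφv
  set Q := B ∩ Metric.ball y (ρ * s) with hQ
  have hQo : IsOpen Q := hB.inter Metric.isOpen_ball
  have hQc : Convex ℝ Q := hc.inter (convex_ball _ _)
  have hsj : 0 < s ^ j := by positivity
  have hφle : ∀ w : W, |φ w| ≤ ‖w‖ := fun w => by
    simpa using φ.le_of_opNorm_le hφ w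
  -- The weighted diagonal derivative is at least `2 * q` at `y` and varies by at most `q` on `Q`.
  have hder : ∀ x ∈ Q, q / s ^ j ≤ |φ (iteratedFDeriv ℝ j G x fun _ => v)| := by
    intro x hx
    rw [div_le_iff₀ hsj]
    have h1 : 2 * q ≤ s ^ j * ‖iteratedFDeriv ℝ j G y fun _ => v‖ := by
      have : 2 * P * (2 * q) ≤ 2 * P * (s ^ j * ‖iteratedFDeriv ℝ j G y fun _ => v‖) := by
        calc 2 * P * (2 * q) = 4 * P * q := by ring
          _ ≤ _ := hlow
          _ ≤ s ^ j * (2 * P * ‖iteratedFDeriv ℝ j G y fun _ => v‖) := by gcongr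
          _ = _ := by ring
      exact le_of_mul_le_mul_left this (by positivity)
    have h2 : s ^ j * |φ (iteratedFDeriv ℝ j G y fun _ => v) -
        φ (iteratedFDeriv ℝ j G x fun _ => v)| ≤ q := by
      refine le_trans ?_ (hosc x hx)
      gcongr
      rw [norm_sub_rev, ← map_sub, ← sub_apply]
      refine (hφle _).trans (((iteratedFDeriv ℝ j G y - iteratedFDeriv ℝ j G x).le_opNorm
        _).trans ?_)
      refine mul_le_of_le_one_right (norm_nonneg _) ?_
      exact Finset.prod_le_one (fun _ _ => norm_nonneg _) fun _ _ => hv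
    have h3 := abs_sub_abs_le_abs_sub (φ (iteratedFDeriv ℝ j G y fun _ => v))
      (φ (iteratedFDeriv ℝ j G x fun _ => v))
    have h4 := mul_le_mul_of_nonneg_left h3 hsj.le
    rw [hφv, abs_of_nonneg (norm_nonneg _)] at h4
    rw [hφv] at h2
    linarith
  set S := {x | x ∈ Q ∧ ‖G x‖ < q * σ ^ k} with hS
  have hSo : IsOpen S := by
    have hcont : ContinuousOn (fun x => ‖G x‖) Q := (hG.continuousOn.mono inter_subset_left).norm
    exact hcont.isOpen_inter_preimage hQo isOpen_Iio
  have hfib : ∀ x, volume {t : ℝ | x + t • v ∈ S} ≤ ENNReal.ofReal (2 ^ (k + 1) * (s * σ)) := by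
    intro x
    have hI : Convex ℝ {t : ℝ | x + t • v ∈ Q} := by
      intro a ha b hb u w hu hw huw
      have e : x + (u • a + w • b) • v = u • (x + a • v) + w • (x + b • v) := by
        ext i
        simp only [Pi.add_apply, Pi.smul_apply, smul_eq_mul]
        linear_combination (-(x i)) * huw
      rw [mem_ofPred_eq, e]
      exact hQc ha hb hu hw huw
    -- With `lam = q / s ^ j` and `t = s * σ` the level `lam * t ^ j` is `q * σ ^ j`, which is at
    -- least `q * σ ^ k` because `σ ≤ 1`.
    have h1 := volume_sublevel_le_of_le_abs_deriv j
      (g := fun i t => φ (iteratedFDeriv ℝ i G (x + t • v) fun _ => v)) hI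
      (fun i hi t ht => hG.hasDerivAt_iteratedFDeriv_line hB (by omega) ht.1 φ)
      (lam := q / s ^ j) (t := s * σ) (by positivity) (by positivity) fun t ht => hder _ ht
    refine (measure_mono fun t ht => ?_).trans (h1.trans (ENNReal.ofReal_le_ofReal ?_))
    · refine ⟨ht.1, ?_⟩
      have h2 : q / s ^ j * (s * σ) ^ j = q * σ ^ j := by rw [mul_pow]; field_simp
      rw [h2]
      calc |φ (iteratedFDeriv ℝ 0 G (x + t • v) fun _ => v)| ≤ ‖G (x + t • v)‖ := by
            simpa using hφle (G (x + t • v))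
        _ < q * σ ^ k := ht.2
        _ ≤ q * σ ^ j :=
            mul_le_mul_of_nonneg_left (pow_le_pow_of_le_one hσ.le hσ1 hj) hq.le
    · have : (2 : ℝ) ^ (j + 1) ≤ 2 ^ (k + 1) := pow_le_pow_right₀ (by norm_num) (by omega)
      have hsσ : 0 < s * σ := by positivity
      nlinarith
  have hR : 0 < ρ * s := by positivity
  have h2 := ofReal_mul_volume_le_of_sections hSo.measurableSet
    (fun x hx => hx.1.2 : S ⊆ Metric.ball y (ρ * s)) hv hfib
  rw [Real.volume_pi_ball _ (by positivity), ← ENNReal.ofReal_mul (by positivity),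
    Fintype.card_fin] at h2
  rw [mul_comm] at h2
  rw [← ENNReal.le_div_iff_mul_le (Or.inl (by simpa using hR)) (Or.inl ENNReal.ofReal_ne_top),
    ← ENNReal.ofReal_div_of_pos hR] at h2
  refine h2.trans (ENNReal.ofReal_le_ofReal (le_of_eq ?_))
  rw [show 2 * (2 * (ρ * s)) = 4 * (ρ * s) by ring]
  field_simp

theorem exists_finset_closedBall_subset (m : ℕ) {ρ : ℝ} (hρ : 0 < ρ) :
    ∃ T : Finset (Fin m → ℝ), ∀ (z : Fin m → ℝ) (s : ℝ), 0 < s →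
      Metric.closedBall z s ⊆ ⋃ t ∈ T, Metric.ball (z + s • t) (ρ * s) := by
  obtain ⟨T, -, hT⟩ := (isCompact_closedBall (0 : Fin m → ℝ) 1).elim_nhds_subcover
    (fun t => Metric.ball t ρ) fun t _ => Metric.ball_mem_nhds t hρ
  refine ⟨T, fun z s hs x hx => ?_⟩
  have h1 : s⁻¹ • (x - z) ∈ Metric.closedBall (0 : Fin m → ℝ) 1 := by
    rw [mem_closedBall_zero_iff, norm_smul, norm_inv, Real.norm_of_nonneg hs.le,
      inv_mul_le_iff₀ hs, mul_one, ← dist_eq_norm]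
    exact hx
  obtain ⟨t, ht, hxt⟩ := mem_iUnion₂.1 (hT h1)
  refine mem_iUnion₂.2 ⟨t, ht, ?_⟩
  rw [mem_ball_iff_norm] at hxt ⊢
  have h2 : x - (z + s • t) = s • (s⁻¹ • (x - z) - t) := by
    rw [smul_sub, smul_inv_smul₀ hs.ne']; abel
  rw [h2, norm_smul, Real.norm_of_nonneg hs.le, mul_comm]
  gcongr

/-- The covering balls have radius `ρ / 2 * s` because their centres may lie outside `B`: a ball
meeting `B` at `y` is contained in the ball of radius `ρ * s` about `y`. -/
theorem volume_le_card_mul_of_forall_inter_ball {ρ : ℝ} {T : Finset (Fin m → ℝ)}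
    (hT : ∀ (z : Fin m → ℝ) (s : ℝ), 0 < s →
      Metric.closedBall z s ⊆ ⋃ t ∈ T, Metric.ball (z + s • t) (ρ / 2 * s)) (hs : 0 < s)
    {z : Fin m → ℝ} (hBz : B ⊆ Metric.closedBall z s) {p : (Fin m → ℝ) → Prop} {M : ℝ≥0∞}
    (h : ∀ y ∈ B, volume {x | x ∈ B ∩ Metric.ball y (ρ * s) ∧ p x} ≤ M) :
    volume {x | x ∈ B ∧ p x} ≤ T.card * M := by
  have hsub : {x | x ∈ B ∧ p x} ⊆
      ⋃ t ∈ T, {x | x ∈ B ∩ Metric.ball (z + s • t) (ρ / 2 * s) ∧ p x} := by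
    rintro x ⟨hx, hpx⟩
    obtain ⟨t, ht, hxt⟩ := mem_iUnion₂.1 (hT z s hs (hBz hx))
    exact mem_iUnion₂.2 ⟨t, ht, ⟨hx, hxt⟩, hpx⟩
  refine (measure_mono hsub).trans ((measure_biUnion_finset_le _ _).trans ?_)
  rw [← nsmul_eq_mul]
  refine Finset.sum_le_card_nsmul _ _ _ fun t _ => ?_
  rcases (B ∩ Metric.ball (z + s • t) (ρ / 2 * s)).eq_empty_or_nonempty with he | ⟨y, hy⟩
  · simp [he]
  · refine (measure_mono ?_).trans (h y hy.1)
    rintro x ⟨hx, hpx⟩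
    refine ⟨⟨hx.1, ?_⟩, hpx⟩
    have h1 := hx.2
    have h2 := hy.2
    rw [Metric.mem_ball] at h1 h2 ⊢
    rw [dist_comm] at h2
    linarith [dist_triangle x (z + s • t) y]

end Core

/-! ### The goodness criterion. -/

section Good

variable {m k : ℕ} {W : Type*} [NormedAddCommGroup W] [NormedSpace ℝ W]
  {B : Set (Fin m → ℝ)}

/-- All that is needed of either kind of ball. The inner radius `s / m` suits Euclidean balls
without square roots, since `m * (s / m) ^ 2 ≤ s ^ 2`; the bound `s ≤ 2 * r` comes from two points
of `B` at distance `s` on a line parallel to the first axis. -/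
theorem IsOpenBall.exists_center_radius (hm : 0 < m) (h : IsOpenBall B) :
    ∃ (z : Fin m → ℝ) (s : ℝ), 0 < s ∧ IsOpen B ∧ Convex ℝ B ∧ z ∈ B ∧
      B ⊆ Metric.closedBall z s ∧ Metric.ball z (s / m) ⊆ B ∧
      ∀ (x₀ : Fin m → ℝ) (r : ℝ), B ⊆ Metric.ball x₀ r → s ≤ 2 * r := by
  have hm' : (1 : ℝ) ≤ m := by exact_mod_cast hm
  obtain ⟨z, s, hs, h⟩ := h
  have hz : ∀ B : Set (Fin m → ℝ), Metric.ball z (s / m) ⊆ B → z ∈ B := fun B h =>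
    h (Metric.mem_ball_self (by positivity))
  have hdiam : (∀ t : ℝ, |t| < s → z + Pi.single ⟨0, hm⟩ t ∈ B) →
      ∀ (x₀ : Fin m → ℝ) (r : ℝ), B ⊆ Metric.ball x₀ r → s ≤ 2 * r := by
    intro h x₀ r hBr
    have h1 := hBr (h (s / 2) (by rw [abs_of_pos (by positivity)]; linarith))
    have h2 := hBr (h (-(s / 2)) (by rw [abs_neg, abs_of_pos (by positivity)]; linarith))
    rw [Metric.mem_ball] at h1 h2
    have h3 : dist (z + Pi.single ⟨0, hm⟩ (s / 2)) (z + Pi.single ⟨0, hm⟩ (-(s / 2))) = s := by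
      rw [dist_add_left, dist_eq_norm, ← Pi.single_sub, Pi.norm_single, sub_neg_eq_add, add_halves,
        Real.norm_of_nonneg hs.le]
    have h4 := dist_triangle_right (z + Pi.single ⟨0, hm⟩ (s / 2))
      (z + Pi.single ⟨0, hm⟩ (-(s / 2))) x₀
    linarith
  refine ⟨z, s, hs, ?_⟩
  rcases h with rfl | rfl
  · have hsub : Metric.ball z (s / m) ⊆ Metric.ball z s :=
      Metric.ball_subset_ball (div_le_self hs.le hm')
    refine ⟨Metric.isOpen_ball, convex_ball _ _, hz _ hsub, Metric.ball_subset_closedBall, hsub,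
      hdiam fun t ht => ?_⟩
    rw [mem_ball_iff_norm, add_sub_cancel_left, Pi.norm_single]
    exact ht
  · have hsub : Metric.ball z (s / m) ⊆ {x | ∑ i, (x i - z i) ^ 2 < s ^ 2} := by
      intro x hx
      rw [Metric.mem_ball] at hx
      have h1 : ∀ i, (x i - z i) ^ 2 ≤ dist x z ^ 2 := fun i => by
        rw [← sq_abs, ← Real.dist_eq]
        exact pow_le_pow_left₀ dist_nonneg (dist_le_pi_dist x z i) 2
      calc ∑ i, (x i - z i) ^ 2 ≤ ∑ _i : Fin m, dist x z ^ 2 := Finset.sum_le_sum fun i _ => h1 i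
        _ = m * dist x z ^ 2 := by simp
        _ < m * (s / m) ^ 2 := by gcongr
        _ = s ^ 2 / m := by field_simp
        _ ≤ s ^ 2 := div_le_self (by positivity) hm'
    have hconv : Convex ℝ {x : Fin m → ℝ | ∑ i, (x i - z i) ^ 2 < s ^ 2} := by
      intro x hx y hy a b ha hb hab
      rw [mem_ofPred_eq] at hx hy ⊢
      have h1 : ∀ i, ((a • x + b • y) i - z i) ^ 2 ≤ a * (x i - z i) ^ 2 + b * (y i - z i) ^ 2 := by
        intro i
        obtain rfl : b = 1 - a := by linarith
        simp only [Pi.add_apply, Pi.smul_apply, smul_eq_mul]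
        nlinarith [mul_nonneg (mul_nonneg ha hb) (sq_nonneg (x i - y i))]
      refine (Finset.sum_le_sum fun i _ => h1 i).trans_lt ?_
      rw [Finset.sum_add_distrib, ← Finset.mul_sum, ← Finset.mul_sum]
      rcases ha.eq_or_lt with rfl | ha
      · obtain rfl : b = 1 := by linarith
        simpa using hy
      · calc _ < a * s ^ 2 + b * s ^ 2 :=
              add_lt_add_of_lt_of_le (by gcongr) (by gcongr)
          _ = s ^ 2 := by rw [← add_mul, hab, one_mul]
    refine ⟨isOpen_lt (by fun_prop) continuous_const, hconv, hz _ hsub, ?_, hsub,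
      hdiam fun t ht => ?_⟩
    · intro x hx
      rw [mem_ofPred_eq] at hx
      rw [Metric.mem_closedBall, dist_pi_le_iff hs.le]
      intro i
      rw [Real.dist_eq]
      refine abs_le_of_sq_le_sq ?_ hs.le
      exact (Finset.single_le_sum (f := fun i => (x i - z i) ^ 2) (fun i _ => sq_nonneg _)
        (Finset.mem_univ i)).trans hx.le
    · rw [mem_ofPred_eq]
      have h1 : ∀ i, ((z + Pi.single ⟨0, hm⟩ t : Fin m → ℝ) i - z i) ^ 2 =
          if i = ⟨0, hm⟩ then t ^ 2 else 0 := by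
        intro i
        rw [Pi.add_apply, add_sub_cancel_left, Pi.single_apply]
        split_ifs <;> simp
      simp only [h1, Finset.sum_ite_eq', Finset.mem_univ, if_true]
      exact sq_lt_sq' (by linarith [(abs_lt.1 ht).1]) (abs_lt.1 ht).2

/-- A function with values in a normed space, some derivative of which of order at most `k` does
not vanish, has a good norm. -/
theorem exists_isGoodOn_norm (W : Type*) [NormedAddCommGroup W] [NormedSpace ℝ W]
    (hm : 0 < m) (k : ℕ) {c α : ℝ} (hc : 0 < c) (hα : 0 < α) (hαk : α * k ≤ 1) :
    ∃ η C : ℝ, 0 < η ∧ 0 < C ∧ ∀ (G : (Fin m → ℝ) → W) (x₀ : Fin m → ℝ) (r : ℝ), r ≤ 1 / 2 →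
      ContDiffOn ℝ k G (Metric.ball x₀ r) →
      (∀ j ≤ k, ∀ x ∈ Metric.ball x₀ r,
        ‖iteratedFDeriv ℝ j G x - iteratedFDeriv ℝ j G x₀‖ ≤ η) →
      (∃ j ≤ k, c ≤ ‖iteratedFDeriv ℝ j G x₀‖) →
      IsGoodOn C α (Metric.ball x₀ r) fun x => ‖G x‖ := by
  set A : ℝ := 2 * 3 ^ k with hA
  have hA1 : 1 ≤ A := by
    have : (1 : ℝ) ≤ 3 ^ k := one_le_pow₀ (by norm_num)
    linarith
  set P : ℝ := 2 ^ k * ((k : ℝ) + 1) ^ k with hP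
  have hP1 : 1 ≤ P := by
    have h1 : (1 : ℝ) ≤ 2 ^ k := one_le_pow₀ (by norm_num)
    have h2 : (1 : ℝ) ≤ ((k : ℝ) + 1) ^ k := one_le_pow₀ (by linarith [k.cast_nonneg (α := ℝ)])
    nlinarith
  set ρ : ℝ := 1 / (4 * P * A ^ 2) with hρ
  have hρ0 : 0 < ρ := by positivity
  obtain ⟨T, hT⟩ := exists_finset_closedBall_subset m (half_pos hρ0)
  set K₁ : ℝ := T.card * (2 ^ (k + 1) / ρ * (2 * ρ * m) ^ m) with hK₁
  have hK₁0 : 0 ≤ K₁ := by positivity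
  set K : ℝ := 4 * P * A ^ 2 with hK
  have hK0 : 0 < K := by positivity
  -- The term `K ^ α` covers the trivial case `1 ≤ K * ε`; `K₁ * K ^ α` comes from the covering. The
  -- value of `η` makes the top-order oscillation `2 * η = (c / 2) / (4 * P * A)`.
  refine ⟨c / (16 * P * A), K₁ * K ^ α + K ^ α, by positivity, by positivity,
    fun G x₀ r hr hG hosc hlow B hB hBr ε hε => ?_⟩
  obtain ⟨z, s, hs, hBo, hBc, hzB, hBz, hzs, hsr⟩ := hB.exists_center_radius hm
  have hs1 : s ≤ 1 := (hsr x₀ r hBr).trans (by linarith)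
  have hGB : ContDiffOn ℝ k G B := hG.mono hBr
  have hdiam : ∀ x ∈ B, ∀ y ∈ B, ‖y - x‖ ≤ 2 * s := by
    intro x hx y hy
    have h1 := hBz hx
    have h2 := hBz hy
    rw [Metric.mem_closedBall] at h1 h2
    rw [← dist_eq_norm]
    linarith [dist_triangle_right y x z]
  have hPA : 1 ≤ P * A := by nlinarith
  have hη : 2 * (c / (16 * P * A)) ≤ c / 2 := by
    rw [mul_div_assoc', div_le_div_iff₀ (by positivity) (by positivity)]
    nlinarith
  have hosc2 : ∀ x ∈ B, ∀ y ∈ B, ‖iteratedFDeriv ℝ k G y - iteratedFDeriv ℝ k G x‖ ≤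
      2 * (c / (16 * P * A)) := by
    intro x hx y hy
    have h1 := hosc k le_rfl x (hBr hx)
    have h2 := hosc k le_rfl y (hBr hy)
    rw [← dist_eq_norm] at h1 h2 ⊢
    linarith [dist_triangle_right (iteratedFDeriv ℝ k G y) (iteratedFDeriv ℝ k G x)
      (iteratedFDeriv ℝ k G x₀)]
  have hlow2 : ∀ x ∈ B, ∃ j ≤ k, c / 2 ≤ ‖iteratedFDeriv ℝ j G x‖ := by
    intro x hx
    obtain ⟨j, hj, h⟩ := hlow
    refine ⟨j, hj, ?_⟩
    have h1 := hosc j hj x (hBr hx)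
    rw [norm_sub_rev] at h1
    have h2 := norm_le_norm_add_norm_sub' (iteratedFDeriv ℝ j G x₀) (iteratedFDeriv ℝ j G x)
    have h3 : 0 < c / (16 * P * A) := by positivity
    linarith
  obtain ⟨N, hN, hNc, hNle, hNge⟩ := hGB.exists_jet_size hBo hBc hs hs1 hdiam hzB
    (half_pos hc) hη hosc2 hlow2
  have hsup : ⨆ y ∈ B, ‖‖G y‖‖ₑ ≤ ENNReal.ofReal (A * N) := by
    refine iSup₂_le fun y hy => ?_
    rw [enorm_norm, ← ofReal_norm]
    exact ENNReal.ofReal_le_ofReal (by simpa using hNle y hy 0 (Nat.zero_le _))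
  by_cases hKε : 1 ≤ K * ε
  · refine (measure_mono fun x hx => hx.1 : _ ≤ volume B).trans ?_
    refine le_mul_of_one_le_left zero_le ?_
    rw [ENNReal.one_le_ofReal, add_mul]
    have h1 : 1 ≤ K ^ α * ε ^ α := by
      rw [← Real.mul_rpow hK0.le hε.le]
      exact Real.one_le_rpow hKε hα.le
    have h2 : 0 ≤ K₁ * K ^ α * ε ^ α := by positivity
    linarith
  push Not at hKε
  have hKε0 : 0 < K * ε := by positivity
  -- Chosen so that `K * ε ≤ σ ^ k`, which is where `α * k ≤ 1` is used. With `q` below, `ε * (A *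
  -- N) = q * (K * ε)`, so the sublevel set lies in `{‖G‖ < q * σ ^ k}`.
  set σ : ℝ := (K * ε) ^ α with hσ
  have hσ0 : 0 < σ := by positivity
  have hσ1 : σ ≤ 1 := Real.rpow_le_one hKε0.le hKε.le hα.le
  have hσk : K * ε ≤ σ ^ k := by
    rw [hσ, ← Real.rpow_natCast, ← Real.rpow_mul hKε0.le]
    calc K * ε = (K * ε) ^ (1 : ℝ) := (Real.rpow_one _).symm
      _ ≤ _ := Real.rpow_le_rpow_of_exponent_ge hKε0 hKε.le hαk
  set q : ℝ := N / (4 * P * A) with hq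
  have hq0 : 0 < q := by positivity
  have hloc : ∀ y ∈ B, volume {x | x ∈ B ∩ Metric.ball y (ρ * s) ∧ ‖G x‖ < q * σ ^ k} ≤
      ENNReal.ofReal (2 ^ (k + 1) * σ / ρ * (4 * (ρ * s)) ^ m) := by
    intro y hy
    obtain ⟨j, hj, hNj⟩ := hNge y hy
    refine hGB.volume_sublevel_inter_ball_le hBo hBc hs hj hy le_rfl hq0 hρ0 ?_
      (fun x hx => ?_) hσ0 hσ1
    · have : 4 * P * q = N / A := by rw [hq]; field_simp
      rw [this, div_le_iff₀ (by positivity), mul_comm]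
      exact hNj
    -- For `j < k` the variation is at most `ρ * (A * N) = q`. For `j = k` there is no next
    -- derivative, and the assumed oscillation bound with `s ^ k * (c / 2) ≤ N` is used instead.
    · rcases hj.lt_or_eq with hjk | rfl
      · have h1 := hx.2
        rw [Metric.mem_ball, dist_eq_norm] at h1
        refine (hGB.pow_mul_norm_iteratedFDeriv_sub_le hBo hBc hs hjk
          (fun x hx => hNle x hx (j + 1) hjk) hy hx.1 h1.le).trans (le_of_eq ?_)
        rw [hq, hρ, hK, ← hA]
        field_simp
      · calc _ ≤ s ^ j * (2 * (c / (16 * P * A))) := by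
              gcongr
              exact hosc2 y hy x hx.1
          _ = s ^ j * (c / 2) / (4 * P * A) := by field_simp; ring
          _ ≤ q := by rw [hq]; gcongr
  have hsub : {x | x ∈ B ∧ ‖‖G x‖‖ₑ < ENNReal.ofReal ε * ⨆ y ∈ B, ‖‖G y‖‖ₑ} ⊆
      {x | x ∈ B ∧ ‖G x‖ < q * σ ^ k} := by
    rintro x ⟨hx, hlt⟩
    refine ⟨hx, ?_⟩
    have h1 := hlt.trans_le (mul_le_mul_right hsup _)
    rw [enorm_norm, ← ofReal_norm, ← ENNReal.ofReal_mul hε.le,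
      ENNReal.ofReal_lt_ofReal_iff_of_nonneg (norm_nonneg _)] at h1
    calc ‖G x‖ < ε * (A * N) := h1
      _ = q * (K * ε) := by rw [hq, hK]; field_simp
      _ ≤ q * σ ^ k := by gcongr
  have hvol : ENNReal.ofReal ((2 * (s / m)) ^ m) ≤ volume B := by
    have hm' : (0 : ℝ) < m := by exact_mod_cast hm
    refine le_trans (le_of_eq ?_) (measure_mono hzs)
    rw [Real.volume_pi_ball _ (by positivity), Fintype.card_fin]
  refine (measure_mono hsub).trans
    ((volume_le_card_mul_of_forall_inter_ball hT hs hBz hloc).trans ?_)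
  refine le_trans ?_ (mul_le_mul_right hvol _)
  rw [← ENNReal.ofReal_natCast, ← ENNReal.ofReal_mul (by positivity),
    ← ENNReal.ofReal_mul (by positivity)]
  refine ENNReal.ofReal_le_ofReal ?_
  have hm' : (m : ℝ) ≠ 0 := by exact_mod_cast hm.ne'
  calc _ = K₁ * σ * (2 * (s / m)) ^ m := by
        have h1 : 4 * (ρ * s) = 2 * ρ * m * (2 * (s / m)) := by field_simp; ring
        rw [h1, mul_pow, hK₁]
        ring
    _ = K₁ * K ^ α * ε ^ α * (2 * (s / m)) ^ m := by
        rw [hσ, Real.mul_rpow hK0.le hε.le]; ring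
    _ ≤ _ := by
        gcongr
        exact le_add_of_nonneg_right (by positivity)

end Good

/-! ### Comparable functions, and the criterion for a function and its gradient. -/

section Criterion

variable {m l : ℕ} {U V : Set (Fin m → ℝ)}

theorem IsGoodOn.mono_const {C C' α : ℝ} {f : (Fin m → ℝ) → ℝ} (h : IsGoodOn C α V f)
    (hC : C ≤ C') : IsGoodOn C' α V f := fun B hB hBV ε hε => by
  refine (h B hB hBV ε hε).trans ?_
  gcongr

/-- A sublevel set of `g` at relative level `ε` lies in that of `f` at level `a * b * ε`. This
passes from the operator norm of the derivative to the supremum norm of the gradient, and undoes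
normalizations. -/
theorem IsGoodOn.of_comparable {C α a b : ℝ} {f g : (Fin m → ℝ) → ℝ} (hf : IsGoodOn C α V f)
    (ha : 0 < a) (hb : 0 < b) (hgf : ∀ x ∈ V, ‖g x‖ ≤ a * ‖f x‖)
    (hfg : ∀ x ∈ V, ‖f x‖ ≤ b * ‖g x‖) : IsGoodOn (C * (a * b) ^ α) α V g := by
  intro B hB hBV ε hε
  have h1 := hf B hB hBV (a * b * ε) (by positivity)
  rw [Real.mul_rpow (by positivity) hε.le, ← mul_assoc] at h1
  refine (measure_mono ?_).trans h1
  rintro x ⟨hx, hlt⟩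
  refine ⟨hx, ?_⟩
  have hb0 : ENNReal.ofReal b ≠ 0 := by simpa using hb
  have e1 : ‖f x‖ₑ ≤ ENNReal.ofReal b * ‖g x‖ₑ := by
    rw [← ofReal_norm, ← ofReal_norm, ← ENNReal.ofReal_mul hb.le]
    exact ENNReal.ofReal_le_ofReal (hfg x (hBV hx))
  have e2 : ⨆ y ∈ B, ‖g y‖ₑ ≤ ENNReal.ofReal a * ⨆ y ∈ B, ‖f y‖ₑ := by
    refine iSup₂_le fun y hy => ?_
    refine le_trans ?_ (mul_le_mul_right (le_iSup₂ (f := fun y (_ : y ∈ B) => ‖f y‖ₑ) y hy) _)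
    rw [← ofReal_norm, ← ofReal_norm, ← ENNReal.ofReal_mul ha.le]
    exact ENNReal.ofReal_le_ofReal (hgf y (hBV hy))
  calc ‖f x‖ₑ ≤ ENNReal.ofReal b * ‖g x‖ₑ := e1
    _ < ENNReal.ofReal b * (ENNReal.ofReal ε * ⨆ y ∈ B, ‖g y‖ₑ) :=
        (ENNReal.mul_lt_mul_iff_right hb0 ENNReal.ofReal_ne_top).2 hlt
    _ ≤ ENNReal.ofReal b * (ENNReal.ofReal ε * (ENNReal.ofReal a * ⨆ y ∈ B, ‖f y‖ₑ)) := by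
        gcongr
    _ = ENNReal.ofReal (a * b * ε) * ⨆ y ∈ B, ‖f y‖ₑ := by
        rw [ENNReal.ofReal_mul (by positivity), ENNReal.ofReal_mul ha.le]
        ring

theorem grad_apply_eq_fderiv {h : (Fin m → ℝ) → ℝ} {x : Fin m → ℝ} (hd : DifferentiableAt ℝ h x)
    (i : Fin m) : grad h x i = fderiv ℝ h x (Pi.single i 1) :=
  hd.lineDeriv_eq_fderiv

theorem norm_grad_le_norm_fderiv {h : (Fin m → ℝ) → ℝ} {x : Fin m → ℝ}
    (hd : DifferentiableAt ℝ h x) : ‖grad h x‖ ≤ ‖fderiv ℝ h x‖ := by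
  refine (pi_norm_le_iff_of_nonneg (norm_nonneg _)).2 fun i => ?_
  rw [grad_apply_eq_fderiv hd]
  simpa [Pi.norm_single] using (fderiv ℝ h x).le_opNorm (Pi.single i 1)

theorem norm_fderiv_le_norm_grad {h : (Fin m → ℝ) → ℝ} {x : Fin m → ℝ}
    (hd : DifferentiableAt ℝ h x) : ‖fderiv ℝ h x‖ ≤ m * ‖grad h x‖ := by
  refine ContinuousLinearMap.opNorm_le_bound _ (by positivity) fun v => ?_
  have hv : v = ∑ i, v i • (Pi.single i (1 : ℝ) : Fin m → ℝ) := by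
    ext k
    simp [Finset.sum_apply, Pi.single_apply]
  conv_lhs => rw [hv, map_sum]
  calc _ ≤ ∑ _i : Fin m, ‖grad h x‖ * ‖v‖ := by
        refine norm_sum_le_of_le _ fun i _ => ?_
        rw [map_smul, norm_smul, ← grad_apply_eq_fderiv hd, mul_comm]
        gcongr
        · exact norm_le_pi_norm (grad h x) i
        · exact norm_le_pi_norm v i
    _ = _ := by simp; ring

theorem norm_iteratedFDeriv_fderiv_sub {E F : Type*} [NormedAddCommGroup E] [NormedSpace ℝ E]
    [NormedAddCommGroup F] [NormedSpace ℝ F] (h : E → F) (j : ℕ) (x y : E) :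
    ‖iteratedFDeriv ℝ j (fderiv ℝ h) x - iteratedFDeriv ℝ j (fderiv ℝ h) y‖ =
      ‖iteratedFDeriv ℝ (j + 1) h x - iteratedFDeriv ℝ (j + 1) h y‖ := by
  rw [iteratedFDeriv_succ_eq_comp_right, iteratedFDeriv_succ_eq_comp_right, Function.comp_apply,
    Function.comp_apply, ← dist_eq_norm, ← dist_eq_norm]
  exact ((continuousMultilinearCurryRightEquiv' ℝ j E F).symm.dist_map _ _).symm

/-- A function whose derivatives up to order `l` vary little, and some derivative of which of
positive order does not vanish, is good, and so is its gradient. -/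
theorem exists_isGoodOn_and_isGoodOn_grad (hm : 0 < m) (hl : 2 ≤ l) {c : ℝ} (hc : 0 < c) :
    ∃ η C : ℝ, 0 < η ∧ 0 < C ∧ ∀ (h : (Fin m → ℝ) → ℝ) (x₀ : Fin m → ℝ) (r : ℝ), r ≤ 1 / 2 →
      ContDiffOn ℝ l h (Metric.ball x₀ r) →
      (∀ j ≤ l, ∀ x ∈ Metric.ball x₀ r,
        ‖iteratedFDeriv ℝ j h x - iteratedFDeriv ℝ j h x₀‖ ≤ η) →
      (∃ j, 0 < j ∧ j ≤ l ∧ c ≤ ‖iteratedFDeriv ℝ j h x₀‖) →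
      IsGoodOn C (1 / ((m : ℝ) * (l : ℝ))) (Metric.ball x₀ r) h ∧
      IsGoodOn C (1 / ((m : ℝ) * ((l : ℝ) - 1))) (Metric.ball x₀ r) fun x => ‖grad h x‖ := by
  obtain ⟨k, rfl⟩ : ∃ k, l = k + 1 := ⟨l - 1, by omega⟩
  have hk : (0 : ℝ) < k := by exact_mod_cast (by omega : 0 < k)
  have hm0 : (0 : ℝ) < m := by exact_mod_cast hm
  have hm1 : (1 : ℝ) / m ≤ 1 := (div_le_one hm0).2 (by exact_mod_cast hm)
  rw [show ((k + 1 : ℕ) : ℝ) - 1 = k by push_cast; ring]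
  obtain ⟨η₁, C₁, hη₁, hC₁, H₁⟩ := exists_isGoodOn_norm ℝ hm (k + 1) hc
    (α := 1 / ((m : ℝ) * ((k + 1 : ℕ) : ℝ))) (by positivity) (by
      refine le_trans (le_of_eq ?_) hm1
      field_simp)
  obtain ⟨η₂, C₂, hη₂, hC₂, H₂⟩ := exists_isGoodOn_norm ((Fin m → ℝ) →L[ℝ] ℝ) hm k hc
    (α := 1 / ((m : ℝ) * (k : ℝ))) (by positivity) (by
      refine le_trans (le_of_eq ?_) hm1
      field_simp)
  refine ⟨min η₁ η₂, max C₁ (C₂ * (1 * m) ^ (1 / ((m : ℝ) * (k : ℝ)))), lt_min hη₁ hη₂,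
    lt_max_of_lt_left hC₁, fun h x₀ r hr hh hosc hlow => ⟨?_, ?_⟩⟩
  · have h1 := H₁ h x₀ r hr hh (fun j hj x hx => (hosc j hj x hx).trans (min_le_left _ _))
      (hlow.imp fun j hj => ⟨hj.2.1, hj.2.2⟩)
    refine IsGoodOn.mono_const ?_ (le_max_left _ _)
    simpa [IsGoodOn] using h1
  · have h1 := H₂ (fderiv ℝ h) x₀ r hr
      (hh.fderiv_of_isOpen Metric.isOpen_ball (by push_cast; exact le_rfl))
      (fun j hj x hx => by
        rw [norm_iteratedFDeriv_fderiv_sub]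
        exact (hosc (j + 1) (by omega) x hx).trans (min_le_right _ _))
      (by
        obtain ⟨j, hj0, hj, hcj⟩ := hlow
        obtain ⟨i, rfl⟩ : ∃ i, j = i + 1 := ⟨j - 1, by omega⟩
        exact ⟨i, by omega, by rwa [norm_iteratedFDeriv_fderiv]⟩)
    have hd : ∀ x ∈ Metric.ball x₀ r, DifferentiableAt ℝ h x := fun x hx =>
      (hh.contDiffAt (Metric.isOpen_ball.mem_nhds hx)).differentiableAt (by simp)
    refine (h1.of_comparable one_pos hm0 (fun x hx => ?_) fun x hx => ?_).mono_const
      (le_max_right _ _)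
    · simpa using norm_grad_le_norm_fderiv (hd x hx)
    · simpa using norm_fderiv_le_norm_grad (hd x hx)

end Criterion

/-! ### Uniformity over compact families and over linear combinations. -/

section Families

variable {m l : ℕ} {U : Set (Fin m → ℝ)}

theorem ContDiffAt.continuousAt_iteratedFDeriv_of_le {E F : Type*} [NormedAddCommGroup E]
    [NormedSpace ℝ E] [NormedAddCommGroup F] [NormedSpace ℝ F] {f : E → F} {x : E}
    (hf : ContDiffAt ℝ l f x) {j : ℕ} (hj : j ≤ l) : ContinuousAt (iteratedFDeriv ℝ j f) x :=
  (hf.iteratedFDeriv_right (i := j) (m := 0) (by simpa using hj)).continuousAt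

theorem ContDiffAt.exists_norm_iteratedFDeriv_sub_le {E F : Type*} [NormedAddCommGroup E]
    [NormedSpace ℝ E] [NormedAddCommGroup F] [NormedSpace ℝ F] {f : E → F} {x₀ : E}
    (hf : ContDiffAt ℝ l f x₀) {η : ℝ} (hη : 0 < η) :
    ∃ r : ℝ, 0 < r ∧ ∀ j ≤ l, ∀ x ∈ Metric.ball x₀ r,
      ‖iteratedFDeriv ℝ j f x - iteratedFDeriv ℝ j f x₀‖ ≤ η := by
  have h1 : ∀ᶠ x in nhds x₀, ∀ j ∈ Finset.range (l + 1),
      ‖iteratedFDeriv ℝ j f x - iteratedFDeriv ℝ j f x₀‖ < η := by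
    rw [Filter.eventually_all_finset]
    intro j hj
    have h2 := hf.continuousAt_iteratedFDeriv_of_le (Nat.lt_succ_iff.1 (Finset.mem_range.1 hj))
    simpa only [dist_eq_norm] using Metric.continuousAt_iff'.1 h2 η hη
  obtain ⟨r, hr, h⟩ := Metric.eventually_nhds_iff_ball.1 h1
  exact ⟨r, hr, fun j hj x hx => (h x hx j (Finset.mem_range.2 (by omega))).le⟩

theorem finite_setOf_multiOrder_le (m l : ℕ) : {β : Fin m → ℕ | multiOrder β ≤ l}.Finite := by
  refine (Set.finite_Iic fun _ : Fin m => l).subset fun β hβ i => ?_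
  exact (Finset.single_le_sum (f := β) (fun _ _ => Nat.zero_le _) (Finset.mem_univ i)).trans hβ

theorem CSpace.eventually_abs_multiDeriv_sub_lt (f : CSpace l U) {K : Set (Fin m → ℝ)}
    (hK : IsCompact K) (hKU : K ⊆ U) {b : ℝ} (hb : 0 < b) :
    ∀ᶠ g : CSpace l U in nhds f, ∀ β : Fin m → ℕ, multiOrder β ≤ l →
      ∀ x ∈ K, ‖multiDeriv β g x - multiDeriv β f x‖ < b := by
  have h1 : ∀ᶠ g : CSpace l U in nhds f, ∀ β ∈ {β : Fin m → ℕ | multiOrder β ≤ l},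
      ∀ x ∈ K, ‖multiDeriv β g x - multiDeriv β f x‖ < b := by
    rw [Filter.eventually_all_finite (finite_setOf_multiOrder_le m l)]
    intro β hβ
    have hc : Continuous fun g : CSpace l U => CSpace.jet g ⟨β, hβ⟩ :=
      (continuous_apply (⟨β, hβ⟩ : {β : Fin m → ℕ // multiOrder β ≤ l})).comp
        (continuous_induced_dom : Continuous CSpace.jet)
    have h2 := UniformOnFun.tendsto_iff_tendstoUniformlyOn.1 (hc.tendsto f) K ⟨hK, hKU⟩
    filter_upwards [Metric.tendstoUniformlyOn_iff.1 h2 b hb] with g hg x hx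
    have := hg x hx
    rw [dist_comm, dist_eq_norm] at this
    exact this
  exact h1

/-- The functions of a compact set are equicontinuous at a point with their derivatives. -/
theorem CSpace.exists_norm_iteratedFDeriv_sub_le (hU : IsOpen U) {x₀ : Fin m → ℝ} (hx₀ : x₀ ∈ U)
    {F : Set (CSpace l U)} (hF : IsCompact F) {η : ℝ} (hη : 0 < η) :
    ∃ r : ℝ, 0 < r ∧ Metric.ball x₀ r ⊆ U ∧ ∀ f ∈ F, ∀ j ≤ l, ∀ x ∈ Metric.ball x₀ r,
      ‖iteratedFDeriv ℝ j (f : (Fin m → ℝ) → ℝ) x - iteratedFDeriv ℝ j f x₀‖ ≤ η := by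
  obtain ⟨r₀, hr₀, hr₀U⟩ := Metric.nhds_basis_closedBall.mem_iff.1 (hU.mem_nhds hx₀)
  have hsub : Metric.ball x₀ r₀ ⊆ U := Metric.ball_subset_closedBall.trans hr₀U
  refine hF.induction_on (p := fun S => ∃ r : ℝ, 0 < r ∧ Metric.ball x₀ r ⊆ U ∧ ∀ f ∈ S, ∀ j ≤ l,
    ∀ x ∈ Metric.ball x₀ r,
      ‖iteratedFDeriv ℝ j (f : (Fin m → ℝ) → ℝ) x - iteratedFDeriv ℝ j f x₀‖ ≤ η)
    ⟨r₀, hr₀, hsub, by simp⟩ ?_ ?_ ?_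
  · rintro S S' hS ⟨r, hr, hrU, h⟩
    exact ⟨r, hr, hrU, fun f hf => h f (hS hf)⟩
  · rintro S S' ⟨r, hr, hrU, h⟩ ⟨r', hr', -, h'⟩
    refine ⟨min r r', lt_min hr hr', (Metric.ball_subset_ball (min_le_left _ _)).trans hrU, ?_⟩
    rintro f (hf | hf) j hj x hx
    · exact h f hf j hj x (Metric.ball_subset_ball (min_le_left _ _) hx)
    · exact h' f hf j hj x (Metric.ball_subset_ball (min_le_right _ _) hx)
  -- Locally near `f`, an `η / 3` argument: continuity of the derivatives of `f` at `x₀`, and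
  -- closeness of `g` to `f` at both `x` and `x₀`. The factor `(m + 1) ^ l` in `b` dominates the
  -- cost `m ^ j` of passing from partial to Fréchet derivatives.
  · intro f _
    set b : ℝ := η / (3 * ((m : ℝ) + 1) ^ l) with hb
    have hb0 : 0 < b := by positivity
    obtain ⟨r, hr, h⟩ := (f.contDiffOn'.contDiffAt (hU.mem_nhds hx₀)).exists_norm_iteratedFDeriv_sub_le
      (η := η / 3) (by positivity)
    refine ⟨_, mem_nhdsWithin_of_mem_nhds
      (f.eventually_abs_multiDeriv_sub_lt (isCompact_closedBall x₀ r₀) hr₀U hb0),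
      min r r₀, lt_min hr hr₀, (Metric.ball_subset_ball (min_le_right _ _)).trans hsub, ?_⟩
    intro g hg j hj x hx
    have key : ∀ y ∈ Metric.closedBall x₀ r₀,
        ‖iteratedFDeriv ℝ j (g : (Fin m → ℝ) → ℝ) y - iteratedFDeriv ℝ j f y‖ ≤ η / 3 := by
      intro y hy
      refine (g.contDiffOn'.norm_iteratedFDeriv_sub_le_of_multiDeriv hU f.contDiffOn' hj (hr₀U hy)
        hb0.le fun β hβ => (hg β (hβ.le.trans hj) y hy).le).trans ?_
      have h1 : (m : ℝ) ^ j ≤ ((m : ℝ) + 1) ^ l :=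
        (pow_le_pow_left₀ (by positivity) (by linarith) j).trans
          (pow_le_pow_right₀ (by linarith [(Nat.cast_nonneg m : (0 : ℝ) ≤ m)]) hj)
      calc (m : ℝ) ^ j * b ≤ ((m : ℝ) + 1) ^ l * b := by gcongr
        _ = η / 3 := by rw [hb]; field_simp
    have k1 := key x (Metric.ball_subset_closedBall
      (Metric.ball_subset_ball (min_le_right _ _) hx))
    have k2 := key x₀ (Metric.mem_closedBall_self hr₀.le)
    have k3 := h j hj x (Metric.ball_subset_ball (min_le_left _ _) hx)
    rw [← dist_eq_norm] at k1 k2 k3 ⊢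
    rw [dist_comm] at k2
    linarith [dist_triangle4 (iteratedFDeriv ℝ j (g : (Fin m → ℝ) → ℝ) x) (iteratedFDeriv ℝ j f x)
      (iteratedFDeriv ℝ j f x₀) (iteratedFDeriv ℝ j g x₀)]

/-- A nondegenerate map has uniformly nondegenerate linear combinations of its components. -/
theorem NondegenerateAt.exists_le_norm_iteratedFDeriv {n : ℕ} {f : (Fin m → ℝ) → (Fin n → ℝ)}
    {x₀ : Fin m → ℝ} (hf : NondegenerateAt l f x₀) :
    ∃ c : ℝ, 0 < c ∧ ∀ L : (Fin n → ℝ) →L[ℝ] ℝ, L ≠ 0 → ∃ j, 0 < j ∧ j ≤ l ∧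
      c * ‖L‖ ≤ ‖iteratedFDeriv ℝ j (L ∘ f) x₀‖ := by
  obtain ⟨⟨r, hr, hfr⟩, hspan⟩ := hf
  let S : Set (Fin m → ℕ) := {β | 0 < multiOrder β ∧ multiOrder β ≤ l}
  have : Finite S := ((finite_setOf_multiOrder_le m l).subset fun β hβ => hβ.2).to_subtype
  have := Fintype.ofFinite S
  -- The spanning condition says exactly that `Λ` is injective; in finite dimension it is then
  -- bounded below, which gives `c`.
  let Λ : ((Fin n → ℝ) →L[ℝ] ℝ) →ₗ[ℝ] (S → ℝ) :=
    { toFun := fun L β => L (multiDeriv β.1 f x₀)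
      map_add' := fun _ _ => rfl
      map_smul' := fun _ _ => rfl }
  have hker : LinearMap.ker Λ = ⊥ := by
    rw [LinearMap.ker_eq_bot']
    intro L hL
    have h1 : (⊤ : Submodule ℝ (Fin n → ℝ)) ≤ LinearMap.ker (L : (Fin n → ℝ) →ₗ[ℝ] ℝ) := by
      rw [← hspan, Submodule.span_le]
      rintro v ⟨β, h0, hl, rfl⟩
      exact congrFun hL ⟨β, h0, hl⟩
    exact ContinuousLinearMap.ext fun v => h1 (Submodule.mem_top (x := v))
  obtain ⟨K, hK, hΛ⟩ := Λ.exists_antilipschitzWith hker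
  have hK' : (0 : ℝ) < K := hK
  refine ⟨1 / K, by positivity, fun L hL => ?_⟩
  by_contra! hcon
  have hL0 : 0 < ‖L‖ := norm_pos_iff.2 hL
  have h1 : ‖L‖ ≤ K * ‖Λ L‖ := hΛ.le_mul_norm (map_zero Λ) L
  have h2 : ‖Λ L‖ < 1 / K * ‖L‖ := by
    rw [pi_norm_lt_iff (by positivity)]
    intro β
    refine lt_of_le_of_lt ?_ (hcon _ β.2.1 β.2.2)
    have hx : x₀ ∈ Metric.ball x₀ r := Metric.mem_ball_self hr
    obtain ⟨a, ha⟩ := multiDeriv_eq_iteratedFDeriv (F := Fin n → ℝ) Metric.isOpen_ball β.2.2 hx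
    change ‖L (multiDeriv β.1 f x₀)‖ ≤ _
    rw [ha f hfr, L.iteratedFDeriv_comp_left (n := l)
      (hfr.contDiffAt (Metric.isOpen_ball.mem_nhds hx)) (by exact_mod_cast β.2.2)]
    simpa [Pi.norm_single] using
      (L.compContinuousMultilinearMap (iteratedFDeriv ℝ (multiOrder β.1) f x₀)).le_opNorm
        fun i => Pi.single (a i) (1 : ℝ)
  have h3 : K * ‖Λ L‖ < K * (1 / K * ‖L‖) := by gcongr
  have h4 : K * (1 / K * ‖L‖) = ‖L‖ := by field_simp
  linarith

theorem iteratedFDeriv_const_eq {E F : Type*} [NormedAddCommGroup E] [NormedSpace ℝ E]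
    [NormedAddCommGroup F] [NormedSpace ℝ F] (a : F) (j : ℕ) (x y : E) :
    iteratedFDeriv ℝ j (fun _ : E => a) x = iteratedFDeriv ℝ j (fun _ : E => a) y := by
  rcases j with _ | j
  · simp [iteratedFDeriv_zero_eq_comp]
  · rw [iteratedFDeriv_const_of_ne (Nat.succ_ne_zero j)]
    rfl

theorem grad_const_mul (t : ℝ) (h : (Fin m → ℝ) → ℝ) (x : Fin m → ℝ) :
    grad (fun y => t * h y) x = t • grad h x := by
  ext i
  simp [grad, partialDeriv, lineDeriv]

theorem NondegenerateAt.exists_isGoodOn_add (hm : 0 < m) (hl : 2 ≤ l) (hU : IsOpen U)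
    {x₀ : Fin m → ℝ} (hx₀ : x₀ ∈ U) {n : ℕ} {f : (Fin m → ℝ) → (Fin n → ℝ)}
    (hf : NondegenerateAt l f x₀) {θ : (Fin m → ℝ) → ℝ} (hθ : ContDiffOn ℝ l θ U) :
    ∃ r : ℝ, 0 < r ∧ Metric.ball x₀ r ⊆ U ∧ ∃ C : ℝ, 0 < C ∧ ∃ H₀ : ℝ, 0 < H₀ ∧
      ∀ L : (Fin n → ℝ) →L[ℝ] ℝ, H₀ ≤ ‖L‖ → ∀ a₀ : ℝ,
        IsGoodOn C (1 / ((m : ℝ) * (l : ℝ))) (Metric.ball x₀ r)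
          (fun x => a₀ + L (f x) + θ x) ∧
        IsGoodOn C (1 / ((m : ℝ) * ((l : ℝ) - 1))) (Metric.ball x₀ r)
          (fun x => ‖grad (fun y => a₀ + L (f y) + θ y) x‖) := by
  obtain ⟨c, hc, hlow⟩ := hf.exists_le_norm_iteratedFDeriv
  obtain ⟨⟨r₁, hr₁, hfr⟩, -⟩ := hf
  obtain ⟨η, C, hη, hC, hgood⟩ := exists_isGoodOn_and_isGoodOn_grad hm hl (half_pos hc)
  have hfx : ContDiffAt ℝ l f x₀ := hfr.contDiffAt (Metric.ball_mem_nhds x₀ hr₁)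
  obtain ⟨r₂, hr₂, hfosc⟩ := hfx.exists_norm_iteratedFDeriv_sub_le (half_pos hη)
  obtain ⟨r₃, hr₃, hθosc⟩ :=
    (hθ.contDiffAt (hU.mem_nhds hx₀)).exists_norm_iteratedFDeriv_sub_le (half_pos hη)
  obtain ⟨r₄, hr₄, hr₄U⟩ := Metric.isOpen_iff.1 hU x₀ hx₀
  set r := min (1 / 2) (min (min r₁ r₂) (min r₃ r₄)) with hr
  have hr0 : 0 < r := by positivity
  have hrr : r ≤ 1 / 2 := min_le_left _ _
  have hrr₁ : Metric.ball x₀ r ⊆ Metric.ball x₀ r₁ := Metric.ball_subset_ball (by simp [hr])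
  have hrr₂ : Metric.ball x₀ r ⊆ Metric.ball x₀ r₂ := Metric.ball_subset_ball (by simp [hr])
  have hrr₃ : Metric.ball x₀ r ⊆ Metric.ball x₀ r₃ := Metric.ball_subset_ball (by simp [hr])
  have hrr₄ : Metric.ball x₀ r ⊆ U := (Metric.ball_subset_ball (by simp [hr])).trans hr₄U
  set M : ℝ := ∑ j ∈ Finset.range (l + 1), ‖iteratedFDeriv ℝ j θ x₀‖ with hM
  have hM0 : 0 ≤ M := Finset.sum_nonneg fun _ _ => norm_nonneg _
  have hθM : ∀ j ≤ l, ‖iteratedFDeriv ℝ j θ x₀‖ ≤ M := fun j hj =>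
    Finset.single_le_sum (f := fun j => ‖iteratedFDeriv ℝ j θ x₀‖) (fun _ _ => norm_nonneg _)
      (Finset.mem_range.2 (by omega))
  -- The summand `1` gives `T⁻¹ ≤ 1`, so that normalizing does not increase the oscillation of `θ`;
  -- the summand `2 * M / c` gives `2 * M ≤ T * c`, so that `θ` removes at most half of the lower
  -- bound.
  refine ⟨r, hr0, hrr₄, C, hC, 1 + 2 * M / c, by positivity, fun L hL a₀ => ?_⟩
  have hMc : 0 ≤ 2 * M / c := by positivity
  have hT : 0 < ‖L‖ := by linarith
  set T := ‖L‖ with hTdef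
  have hT1 : T⁻¹ ≤ 1 := inv_le_one_of_one_le₀ (by linarith)
  have hx₀r : x₀ ∈ Metric.ball x₀ r := Metric.mem_ball_self hr0
  have hfc : ∀ x ∈ Metric.ball x₀ r, ContDiffAt ℝ l f x := fun x hx =>
    hfr.contDiffAt (Metric.isOpen_ball.mem_nhds (hrr₁ hx))
  have hθc : ∀ x ∈ Metric.ball x₀ r, ContDiffAt ℝ l θ x := fun x hx =>
    hθ.contDiffAt (hU.mem_nhds (hrr₄ hx))
  have hLc : ∀ x ∈ Metric.ball x₀ r, ContDiffAt ℝ l (L ∘ f) x := fun x hx =>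
    L.contDiff.contDiffAt.comp x (hfc x hx)
  set u : (Fin m → ℝ) → ℝ := fun x => a₀ + L (f x) + θ x with hu
  have huc : ∀ x ∈ Metric.ball x₀ r, ContDiffAt ℝ l u x := fun x hx =>
    (contDiffAt_const.add (hLc x hx)).add (hθc x hx)
  have hD : ∀ j ≤ l, ∀ x ∈ Metric.ball x₀ r, iteratedFDeriv ℝ j (fun x => T⁻¹ * u x) x =
      T⁻¹ • (iteratedFDeriv ℝ j (fun _ : Fin m → ℝ => a₀) x + iteratedFDeriv ℝ j (L ∘ f) x +
        iteratedFDeriv ℝ j θ x) := by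
    intro j hj x hx
    have hj' : (j : WithTop ℕ∞) ≤ l := by exact_mod_cast hj
    have e1 := iteratedFDeriv_const_smul_apply (𝕜 := ℝ) (a := T⁻¹) ((huc x hx).of_le hj')
    have e2 := iteratedFDeriv_add_apply (𝕜 := ℝ)
      (((contDiffAt_const (c := a₀)).add (hLc x hx)).of_le hj') ((hθc x hx).of_le hj')
    have e3 := iteratedFDeriv_add_apply (𝕜 := ℝ)
      ((contDiffAt_const (c := a₀)).of_le hj') ((hLc x hx).of_le hj')
    exact e1.trans (congrArg (T⁻¹ • ·) (e2.trans (congrArg (· + _) e3)))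
  obtain ⟨g1, g2⟩ := hgood (fun x => T⁻¹ * u x) x₀ r hrr
    (fun x hx => (contDiffAt_const.mul (huc x hx)).contDiffWithinAt) (fun j hj x hx => by
      have hj' : (j : WithTop ℕ∞) ≤ l := by exact_mod_cast hj
      rw [hD j hj x hx, hD j hj x₀ hx₀r, ← smul_sub, iteratedFDeriv_const_eq a₀ j x x₀,
        add_sub_add_comm, add_sub_add_left_eq_sub, L.iteratedFDeriv_comp_left (hfc x hx) hj',
        L.iteratedFDeriv_comp_left (hfc x₀ hx₀r) hj']
      have e1 : L.compContinuousMultilinearMap (iteratedFDeriv ℝ j f x) -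
          L.compContinuousMultilinearMap (iteratedFDeriv ℝ j f x₀) =
          L.compContinuousMultilinearMap (iteratedFDeriv ℝ j f x - iteratedFDeriv ℝ j f x₀) := by
        ext v; simp
      have e2 : ‖L.compContinuousMultilinearMap
          (iteratedFDeriv ℝ j f x - iteratedFDeriv ℝ j f x₀)‖ ≤ T * (η / 2) :=
        (L.norm_compContinuousMultilinearMap_le _).trans (by
          gcongr
          exact hfosc j hj x (hrr₂ hx))
      have e3 := hθosc j hj x (hrr₃ hx)
      rw [e1, norm_smul, norm_inv, Real.norm_of_nonneg hT.le]
      calc _ ≤ T⁻¹ * (T * (η / 2) + η / 2) := by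
            gcongr
            exact (norm_add_le _ _).trans (add_le_add e2 e3)
        _ = η / 2 + T⁻¹ * (η / 2) := by field_simp
        _ ≤ η / 2 + 1 * (η / 2) := by gcongr
        _ = η := by ring)
    (by
      obtain ⟨j, hj0, hj, h⟩ := hlow L (norm_pos_iff.1 hT)
      refine ⟨j, hj0, hj, ?_⟩
      rw [hD j hj x₀ hx₀r, iteratedFDeriv_const_of_ne hj0.ne', Pi.zero_apply, zero_add, norm_smul,
        norm_inv, Real.norm_of_nonneg hT.le, inv_mul_eq_div, le_div_iff₀ hT]
      have e1 := norm_sub_le_norm_add (iteratedFDeriv ℝ j (L ∘ f) x₀) (iteratedFDeriv ℝ j θ x₀)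
      have e2 := hθM j hj
      have e3 : 2 * M ≤ T * c := by
        rw [← div_le_iff₀ hc]
        linarith
      linarith)
  have hTT : T * T⁻¹ = 1 := mul_inv_cancel₀ hT.ne'
  constructor
  -- The comparison constants are inverse to each other, so `C` does not depend on `L`.
  · have := g1.of_comparable (g := u) (a := T) (b := T⁻¹) hT (by positivity)
      (fun x _ => by
        rw [norm_mul, norm_inv, Real.norm_of_nonneg hT.le, ← mul_assoc, hTT, one_mul])
      (fun x _ => by rw [norm_mul, norm_inv, Real.norm_of_nonneg hT.le])
    simpa [hTT] using this
  · have := g2.of_comparable (g := fun x => ‖grad u x‖) (a := T) (b := T⁻¹) hT (by positivity)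
      (fun x _ => by
        rw [grad_const_mul, norm_smul, norm_inv, Real.norm_of_nonneg hT.le, norm_mul, norm_inv,
          Real.norm_of_nonneg hT.le, ← mul_assoc, hTT, one_mul])
      (fun x _ => by
        rw [grad_const_mul, norm_smul, norm_inv, Real.norm_of_nonneg hT.le, norm_mul, norm_inv,
          Real.norm_of_nonneg hT.le])
    simpa [hTT] using this

theorem CSpace.exists_isGoodOn_add (hm : 0 < m) (hl : 2 ≤ l) (hU : IsOpen U)
    {x₀ : Fin m → ℝ} (hx₀ : x₀ ∈ U) {F : Set (CSpace l U)} (hF : IsCompact F) {c : ℝ} (hc : 0 < c)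
    (hlow : ∀ f ∈ F, ∃ β : Fin m → ℕ,
      0 < multiOrder β ∧ multiOrder β ≤ l ∧ c ≤ |multiDeriv β f x₀|) :
    ∃ r : ℝ, 0 < r ∧ Metric.ball x₀ r ⊆ U ∧ ∃ C : ℝ, 0 < C ∧ ∃ δ : ℝ, 0 < δ ∧
      ∀ Θ : CSpace l U,
        (∀ x ∈ U, ∀ β : Fin m → ℕ, multiOrder β ≤ l → |multiDeriv β Θ x| ≤ δ) →
        ∀ f ∈ F,
          IsGoodOn C (1 / ((m : ℝ) * (l : ℝ))) (Metric.ball x₀ r) (fun x => f x + Θ x) ∧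
          IsGoodOn C (1 / ((m : ℝ) * ((l : ℝ) - 1))) (Metric.ball x₀ r)
            (fun x => ‖grad (fun y => f y + Θ y) x‖) := by
  obtain ⟨η, C, hη, hC, hgood⟩ := exists_isGoodOn_and_isGoodOn_grad hm hl (half_pos hc)
  obtain ⟨r₁, hr₁, hr₁U, hosc⟩ := CSpace.exists_norm_iteratedFDeriv_sub_le hU hx₀ hF (half_pos hη)
  set r := min (1 / 2) r₁ with hr
  have hr0 : 0 < r := by positivity
  have hrr₁ : Metric.ball x₀ r ⊆ Metric.ball x₀ r₁ := Metric.ball_subset_ball (min_le_right _ _)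
  have hrU := hrr₁.trans hr₁U
  -- The Fréchet derivatives of `Θ` are then at most `η / 4`, counted at both `x` and `x₀`, and at
  -- most `c / 2`, leaving half of the lower bound.
  set δ : ℝ := min (η / 4) (c / 2) / ((m : ℝ) + 1) ^ l with hδ
  have hδ0 : 0 < δ := by positivity
  refine ⟨r, hr0, hrU, C, hC, δ, hδ0, fun Θ hΘ f hf => ?_⟩
  have hΘD : ∀ j ≤ l, ∀ x ∈ U, ‖iteratedFDeriv ℝ j (Θ : (Fin m → ℝ) → ℝ) x‖ ≤
      min (η / 4) (c / 2) := by
    intro j hj x hx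
    refine (Θ.contDiffOn'.norm_iteratedFDeriv_le_of_multiDeriv hU hj hx hδ0.le
      fun β hβ => hΘ x hx β (hβ.le.trans hj)).trans ?_
    have h1 : (m : ℝ) ^ j ≤ ((m : ℝ) + 1) ^ l :=
      (pow_le_pow_left₀ (by positivity) (by linarith) j).trans
        (pow_le_pow_right₀ (by linarith [(Nat.cast_nonneg m : (0 : ℝ) ≤ m)]) hj)
    calc (m : ℝ) ^ j * δ ≤ ((m : ℝ) + 1) ^ l * δ := by gcongr
      _ = min (η / 4) (c / 2) := by rw [hδ]; field_simp
  have hD : ∀ j ≤ l, ∀ x ∈ U, iteratedFDeriv ℝ j (fun x => f x + Θ x) x =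
      iteratedFDeriv ℝ j f x + iteratedFDeriv ℝ j Θ x := by
    intro j hj x hx
    have hj' : (j : WithTop ℕ∞) ≤ l := by exact_mod_cast hj
    exact iteratedFDeriv_add_apply ((f.contDiffOn'.contDiffAt (hU.mem_nhds hx)).of_le hj')
      ((Θ.contDiffOn'.contDiffAt (hU.mem_nhds hx)).of_le hj')
  refine hgood _ x₀ r (min_le_left _ _) ((f.contDiffOn'.add Θ.contDiffOn').mono hrU)
    (fun j hj x hx => ?_) ?_
  · rw [hD j hj x (hrU hx), hD j hj x₀ hx₀, add_sub_add_comm]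
    have e1 := hosc f hf j hj x (hrr₁ hx)
    have e2 := (hΘD j hj x (hrU hx)).trans (min_le_left _ _)
    have e3 := (hΘD j hj x₀ hx₀).trans (min_le_left _ _)
    refine (norm_add_le _ _).trans ?_
    linarith [norm_sub_le (iteratedFDeriv ℝ j (Θ : (Fin m → ℝ) → ℝ) x) (iteratedFDeriv ℝ j Θ x₀)]
  · obtain ⟨β, hβ0, hβ, h⟩ := hlow f hf
    refine ⟨multiOrder β, hβ0, hβ, ?_⟩
    rw [hD _ hβ x₀ hx₀]
    have e1 := norm_sub_le_norm_add (iteratedFDeriv ℝ (multiOrder β) (f : (Fin m → ℝ) → ℝ) x₀)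
      (iteratedFDeriv ℝ (multiOrder β) Θ x₀)
    have e2 := (hΘD _ hβ x₀ hx₀).trans (min_le_right _ _)
    have e3 := f.contDiffOn'.norm_multiDeriv_le hU hβ hx₀
    rw [Real.norm_eq_abs] at e3
    linarith

end Families

theorem mainTheorem7 {m : ℕ} (hm : 0 < m) {l : ℕ} (hl : 2 ≤ l)
    {U : Set (Fin m → ℝ)} (hU : IsOpen U) {x₀ : Fin m → ℝ} (hx₀ : x₀ ∈ U) :
    (∀ F : Set (CSpace l U), IsCompact F →
      (∃ c : ℝ, 0 < c ∧ ∀ f ∈ F, ∃ β : Fin m → ℕ,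
        0 < multiOrder β ∧ multiOrder β ≤ l ∧ c ≤ |multiDeriv β f x₀|) →
      ∃ V : Set (Fin m → ℝ), IsOpen V ∧ x₀ ∈ V ∧ V ⊆ U ∧
        ∃ C : ℝ, 0 < C ∧ ∃ δ : ℝ, 0 < δ ∧
          ∀ Θ : CSpace l U,
            (∀ x ∈ U, ∀ β : Fin m → ℕ, multiOrder β ≤ l → |multiDeriv β Θ x| ≤ δ) →
            ∀ f ∈ F,
              IsGoodOn C (1 / ((m : ℝ) * (l : ℝ))) V (fun x => f x + Θ x) ∧
              IsGoodOn C (1 / ((m : ℝ) * ((l : ℝ) - 1))) V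
                (fun x => ‖grad (fun y => f y + Θ y) x‖)) ∧
    (∀ (n : ℕ) (f : (Fin m → ℝ) → (Fin n → ℝ)), NondegenerateAt l f x₀ →
      ∀ θ : CSpace l U,
      ∃ V : Set (Fin m → ℝ), IsOpen V ∧ x₀ ∈ V ∧ V ⊆ U ∧
        ∃ C : ℝ, 0 < C ∧ ∃ H₀ : ℝ, 0 < H₀ ∧
          ∀ a : Fin n → ℝ, H₀ ≤ ‖a‖ →
            (∀ a₀ : ℝ, IsGoodOn C (1 / ((m : ℝ) * (l : ℝ))) V
              (fun x => a₀ + ∑ i, a i * f x i + θ x)) ∧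
            IsGoodOn C (1 / ((m : ℝ) * ((l : ℝ) - 1))) V
              (fun x => ‖grad (fun y => ∑ i, a i * f y i + θ y) x‖)) := by
  refine ⟨fun F hF ⟨c, hc, hlow⟩ => ?_, fun n f hf θ => ?_⟩
  · obtain ⟨r, hr, hrU, h⟩ := CSpace.exists_isGoodOn_add hm hl hU hx₀ hF hc hlow
    exact ⟨_, Metric.isOpen_ball, Metric.mem_ball_self hr, hrU, h⟩
  · obtain ⟨r, hr, hrU, C, hC, H₀, hH₀, h⟩ := hf.exists_isGoodOn_add hm hl hU hx₀ θ.contDiffOn'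
    refine ⟨_, Metric.isOpen_ball, Metric.mem_ball_self hr, hrU, C, hC, H₀, hH₀, fun a ha => ?_⟩
    let L : (Fin n → ℝ) →L[ℝ] ℝ := ∑ i, a i • ContinuousLinearMap.proj i
    have hL : ∀ v, L v = ∑ i, a i * v i := fun v => by simp [L]
    have hLa : ‖a‖ ≤ ‖L‖ := by
      refine (pi_norm_le_iff_of_nonneg (norm_nonneg _)).2 fun i => ?_
      have h1 := L.le_opNorm (Pi.single i 1)
      rw [hL, Pi.norm_single, norm_one, mul_one] at h1
      simpa [Pi.single_apply] using h1
    have h2 := h L (ha.trans hLa)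
    simp only [hL] at h2
    exact ⟨fun a₀ => (h2 a₀).1, by simpa using (h2 0).2⟩
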